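/- For $n\in\mathbb N$ put $N=2^n$, and let $E:\{0,1\}^n\to\mathbb Z_{\ge 0}$ be an energy function with $E(s)\le m$ for all $s$. Let $N_0=\#\{s: E(s)=0\}$, and assume $0<N_0<N$. On $(\mathbb C^2)^{\otimes n}$ with computational basis $|s\rangle$ let $$H(z)=H_0+zH_f,\qquad H_0=-|\phi\rangle\langle\phi|,\quad |\phi\rangle=\tfrac1{\sqrt N}\sum_s|s\rangle,\qquad H_f=\sum_s E(s)|s\rangle\langle s| .$$ Let $\mathcal H_a$ be the span of the states $\sum_{s:E(s)=e}|s\rangle$, one for each energy $e$; it contains $|\phi\rangle$ and is invariant under every $H(z)$. Let $\lambda_0(z)<\lambda_1(z)$ be the two lowest distinct eigenvalues of $H(z)$ restricted to $\mathcal H_a$, and let $g(z)=\lambda_1(z)-\lambda_0(z)$ be the spectral gap. Lemma. For all polynomials $M,Q$ with natural-number coefficients there is a polynomial $P$, depending only on $M$ and $Q$, such that the following holds for every $n$, every $E$ as above with $m\le M(n)$, and every endpoint $0<z_f\le Q(n)$. (For every constant $\delta>0$ this includes, with a suitable constant $Q$, the endpoint $z_f=z_*+\sqrt{4N_0Z_2/(N\delta)}$,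 where $z_*$ is a minimizer of $g$ on $[0,\infty)$ and $Z_2=\frac1N\sum_{s:E(s)>0}E(s)^{-2}$; indeed this $z_f$ is at most $2+2\delta^{-1/2}$.) The gap $g$ is positive on $[0,z_f]$ and, with $c=\int_0^{z_f}g(z)^{-2}\,dz$, there is a twice continuously differentiable schedule $z:[0,1]\to\mathbb R$ solving $$\dot z(\beta)=c\,g(z(\beta))^2,\qquad z(0)=0,\quad z(1)=z_f,$$ which achieves running time $O(\sqrt{N/N_0})$ up to polynomial factors, in both of the following senses. 1. The adiabatic-theorem cost of the path $\beta\mapsto H(z(\beta))$ satisfies $$C:=2\max_{\beta\in[0,1]}\frac{\|\dot H\|}{g^2}+\int_0^1\Big(\frac{\|\ddot H\|}{g^2}+\frac{7\|\dot H\|^2}{g^3}\Big)d\beta\;\le\;P(n)\sqrt{N/N_0},$$ where dots are derivatives in $\beta$, norms are operator norms, and $g=g(z(\beta))$. 2. For every $\varepsilon>0$ and every total evolution time $T\ge\frac1\varepsilon P(n)\sqrt{N/N_0}$, the solution of $i\,\frac{d}{dt}\psi(t)=H(z(t/T))\,\psi(t)$ on $[0,T]$ with $\psi(0)=|\phi\rangle$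 satisfies $\|\psi(T)-v\|<\varepsilon$ for some normalized ground state $v$ of $H(z_f)$. -/

import Mathlib

open Set MeasureTheory
open scoped ENNReal

noncomputable section

namespace Annealing

/-- The Hilbert space of `n` qubits, with coordinates in the computational basis `|s⟩`,
`s` ranging over the `2 ^ n` bit strings. -/
abbrev Qubits (n : ℕ) : Type := EuclideanSpace ℂ (Fin n → Bool)

/-- The equal superposition state `φ = N^(-1/2) ∑ₛ |s⟩`, with `N = 2 ^ n`. -/
def uniformState (n : ℕ) : Qubits n :=
  WithLp.toLp 2 fun _ => ((1 / Real.sqrt (2 ^ n) : ℝ) : ℂ)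

/-- The mixing Hamiltonian `H₀ = -|φ⟩⟨φ|`. -/
def mixingHamiltonian (n : ℕ) : Qubits n →L[ℂ] Qubits n :=
  -InnerProductSpace.rankOne ℂ (uniformState n) (uniformState n)

variable {n : ℕ}

/-- The diagonal target Hamiltonian `H_f = ∑ₛ E(s) |s⟩⟨s|`. -/
def targetHamiltonian (E : (Fin n → Bool) → ℕ) : Qubits n →L[ℂ] Qubits n :=
  Matrix.toEuclideanCLM (𝕜 := ℂ) (Matrix.diagonal fun s => (E s : ℂ))

/-- The model Hamiltonian `H(z) = H₀ + z H_f`. -/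
def hamiltonian (E : (Fin n → Bool) → ℕ) (z : ℝ) : Qubits n →L[ℂ] Qubits n :=
  mixingHamiltonian n + (z : ℂ) • targetHamiltonian E

/-- The number `N₀` of bit strings of energy `0`. -/
def numSolutions (E : (Fin n → Bool) → ℕ) : ℕ :=
  (Finset.univ.filter fun s => E s = 0).card

/-- The subspace spanned by the states `∑_{s : E(s) = e} |s⟩`, one for each energy `e`: the vectors
whose amplitude at `s` depends on `E(s)` only. It contains `φ` and is invariant under every `H(z)`,
so that the evolution started in `φ` never leaves it. -/
def symmetricSubspace (E : (Fin n → Bool) → ℕ) : Submodule ℂ (Qubits n) where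
  carrier := {v | ∀ s t, E s = E t → v s = v t}
  zero_mem' := fun _ _ _ => rfl
  add_mem' := fun {v w} hv hw s t h => by
    simp only [PiLp.add_apply, hv s t h, hw s t h]
  smul_mem' := fun a v hv s t h => by
    simp only [PiLp.smul_apply, hv s t h]

/-- The energy levels of `H(z)` on the symmetric subspace. -/
def symmetricLevels (E : (Fin n → Bool) → ℕ) (z : ℝ) : Set ℝ :=
  {μ | ∃ v ∈ symmetricSubspace E, v ≠ 0 ∧ hamiltonian E z v = (μ : ℂ) • v}

/-- The lowest energy level `λ₀(z)` on the symmetric subspace. -/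
def level₀ (E : (Fin n → Bool) → ℕ) (z : ℝ) : ℝ :=
  sInf (symmetricLevels E z)

/-- The second lowest energy level `λ₁(z)` on the symmetric subspace. -/
def level₁ (E : (Fin n → Bool) → ℕ) (z : ℝ) : ℝ :=
  sInf (symmetricLevels E z \ {level₀ E z})

/-- The spectral gap `g(z) = λ₁(z) - λ₀(z)`. -/
def gap (E : (Fin n → Bool) → ℕ) (z : ℝ) : ℝ :=
  level₁ E z - level₀ E z

/-- `z : [0, 1] → ℝ` is a twice continuously differentiable schedule with endpoint `zf` that solves
the boundary-value problem `ż = c g(z)²`, `z(0) = 0`, `z(1) = zf`. -/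
structure IsLocalSchedule (E : (Fin n → Bool) → ℕ) (zf c : ℝ) (z : ℝ → ℝ) : Prop where
  contDiffOn : ContDiffOn ℝ 2 z (Icc 0 1)
  initial : z 0 = 0
  final : z 1 = zf
  ode : ∀ β ∈ Icc (0 : ℝ) 1, HasDerivWithinAt z (c * gap E (z β) ^ 2) (Icc 0 1) β

/-- The quantity
`C = 2 max_β ‖Ḣ‖ / g² + ∫₀¹ (‖Ḧ‖ / g² + 7 ‖Ḣ‖² / g³) dβ`
of the adiabatic theorem along the path `H(z(β))`, `0 ≤ β ≤ 1`, as an extended nonnegative real;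
dots are derivatives in `β` and norms are operator norms. -/
def adiabaticCost (E : (Fin n → Bool) → ℕ) (z : ℝ → ℝ) : ℝ≥0∞ :=
  2 * (⨆ β ∈ Icc (0 : ℝ) 1,
      ‖derivWithin (fun b => hamiltonian E (z b)) (Icc 0 1) β‖ₑ
        / ENNReal.ofReal (gap E (z β)) ^ 2)
  + ∫⁻ β in Icc (0 : ℝ) 1,
      (‖iteratedDerivWithin 2 (fun b => hamiltonian E (z b)) (Icc 0 1) β‖ₑ
          / ENNReal.ofReal (gap E (z β)) ^ 2
        + 7 * ‖derivWithin (fun b => hamiltonian E (z b)) (Icc 0 1) β‖ₑ ^ 2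
          / ENNReal.ofReal (gap E (z β)) ^ 3)

/-- `ψ : [0, T] → Qubits n` starts in `φ` and solves the Schrödinger equation
`i dψ/dt = H(z(t / T)) ψ`. -/
structure IsEvolution (E : (Fin n → Bool) → ℕ) (z : ℝ → ℝ) (T : ℝ) (ψ : ℝ → Qubits n) : Prop where
  initial : ψ 0 = uniformState n
  schrodinger : ∀ t ∈ Icc (0 : ℝ) T,
    HasDerivWithinAt ψ (-Complex.I • hamiltonian E (z (t / T)) (ψ t)) (Icc 0 T) t

/-- `v` is a normalized ground state of `A`: a unit eigenvector for the least eigenvalue of `A` on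
the whole space. -/
def IsGroundState (A : Qubits n →L[ℂ] Qubits n) (v : Qubits n) : Prop :=
  ‖v‖ = 1 ∧ ∃ μ : ℝ, A v = (μ : ℂ) • v ∧
    ∀ (ν : ℝ) (w : Qubits n), w ≠ 0 → A w = (ν : ℂ) • w → μ ≤ ν

end Annealing

end

/-!
On the symmetric subspace `H(z)` is a rank-one perturbation of a diagonal operator, so its
eigenvalues `λ` solve the secular equation `N⁻¹ ∑ₛ 1 / (z E(s) - λ) = 1`. The substitutions
`λ₀ = -z / t` and `λ₁ = z u` turn it into `secularGround E t = z` and `secularExcited E u = z`, two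
equations with monotone left-hand sides. Hence `t` and `u`, and with them the gap
`g = λ₁ - λ₀` and the ground state, are smooth functions of `z`, also across `z = 0`, where the upper
levels of `H` coalesce (`level₀_eq`, `level₁_eq`, `contDiffAt_secularGap`).

Elementary estimates of the secular equation give `g(z) ≥ |z - Z₁|` with `Z₁` the mean of `E(s)⁻¹`
over the nonzero energies (`abs_sub_le_secularGap`), and `g(z) ≥ √(N₀ / N) / (8 m)`
(`sqrt_le_secularGap`). So `g` lies above a multiple of a hyperbola, and with `R = √(N / N₀)` the
integral `c` of `g⁻²` is `O(m R)`, while the integral `L` of `g⁻¹` is only logarithmic in `R`, hence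
polynomial in `n`. Both levels have slopes in `[0, m]`, so that `|g'| ≤ m`; together with
`ż = c g²` and `c g dβ = dz / g` this bounds the adiabatic cost by `2 c m + 9 m² c L`
(`IsSecularSchedule.adiabaticCost_le`), and `cost_lt` bounds that by a polynomial times `R`.

For the evolution let `v` be the ground state, and `w ⟂ v` the symmetric solution of
`(H - λ₀) w = dv/dz`. The spectral theorem bounds the inverse of `H - λ₀` on the symmetric vectors
orthogonal to `v` by `1 / g`, and differentiating `(H - λ₀) v = 0` and the equation of `w` gives
`‖w‖ ≤ m / g²` and `‖dw/dz‖ ≤ 4 m² / g³` (`exists_corrector_bounds`). With the dynamical phase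
`p`, the vector `ψ - p v - (i / T) p ż w` solves the Schrödinger equation up to an error of norm at
most `6 m² c² g / T`, and the evolution preserves norms, so `ψ(T)` is within
`(2 c m + 6 m² c L) / T` of a ground state (`IsSecularSchedule.exists_norm_sub_le`). Working with this
vector rather than with the overlap `⟨v, ψ⟩` is what makes the required time proportional
to `1 / ε`.
-/

noncomputable section

namespace Annealing

/-! ### Inverses of smooth injective functions -/

/-- Near `f a`, the inverse of `f` on `U` agrees with the local inverse of the inverse function
theorem. -/
theorem contDiffAt_invFunOn {k : WithTop ℕ∞} (hk : k ≠ 0) {f : ℝ → ℝ} {U : Set ℝ} (hU : IsOpen U)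
    (hinj : InjOn f U) {a f' : ℝ} (ha : a ∈ U) (hf : ContDiffAt ℝ k f a) (hd : HasDerivAt f f' a)
    (hf' : f' ≠ 0) : ContDiffAt ℝ k (Function.invFunOn f U) (f a) := by
  have hd' : HasFDerivAt f ((ContinuousLinearEquiv.unitsEquivAut ℝ (Units.mk0 f' hf') :
      ℝ ≃L[ℝ] ℝ) : ℝ →L[ℝ] ℝ) a := by
    have : ((ContinuousLinearEquiv.unitsEquivAut ℝ (Units.mk0 f' hf') : ℝ ≃L[ℝ] ℝ) : ℝ →L[ℝ] ℝ)
        = ContinuousLinearMap.toSpanSingleton ℝ f' := by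
      ext; simp
    rw [this]
    exact hd.hasFDerivAt
  have hL := hf.to_localInverse hd' hk
  refine hL.congr_of_eventuallyEq ?_
  have hs := hf.hasStrictFDerivAt' hd' hk
  have h1 : ∀ᶠ y in nhds (f a), f (hf.localInverse hd' hk y) = y :=
    hs.eventually_right_inverse
  have h2 : ∀ᶠ y in nhds (f a), hf.localInverse hd' hk y ∈ U := by
    apply hL.continuousAt.eventually_mem
    rw [hf.localInverse_apply_image hd' hk]
    exact hU.mem_nhds ha
  filter_upwards [h1, h2] with y hy hyU
  have hex : ∃ x ∈ U, f x = y := ⟨_, hyU, hy⟩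
  exact hinj (Function.invFunOn_mem hex) hyU ((Function.invFunOn_eq hex).trans hy.symm)

theorem image_mem_nhds_of_hasDerivAt {f : ℝ → ℝ} {U : Set ℝ} (hU : IsOpen U) {a f' : ℝ}
    (ha : a ∈ U) (hf : ContDiffAt ℝ 1 f a) (hd : HasDerivAt f f' a) (hf' : f' ≠ 0) :
    f '' U ∈ nhds (f a) := by
  rw [← (hf.hasStrictDerivAt' hd one_ne_zero).map_nhds_eq hf']
  exact Filter.image_mem_map (hU.mem_nhds ha)

theorem hasDerivAt_invFunOn {f : ℝ → ℝ} {U : Set ℝ} (hU : IsOpen U) (hinj : InjOn f U) {a f' : ℝ}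
    (ha : a ∈ U) (hf : ContDiffAt ℝ 1 f a) (hd : HasDerivAt f f' a) (hf' : f' ≠ 0) :
    HasDerivAt (Function.invFunOn f U) f'⁻¹ (f a) := by
  have h1 : Function.invFunOn f U (f a) = a := hinj.leftInvOn_invFunOn ha
  refine HasDerivAt.of_local_left_inverse
    (contDiffAt_invFunOn one_ne_zero hU hinj ha hf hd hf').continuousAt (by rwa [h1]) hf' ?_
  filter_upwards [image_mem_nhds_of_hasDerivAt hU ha hf hd hf'] with y hy
  exact Function.invFunOn_eq hy

/-! ### Averages over the bit strings -/

variable {n : ℕ}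

/-- The average over all bit strings `s` of `f (E s)`, for a function `f` of the energy. -/
def energyMean (E : (Fin n → Bool) → ℕ) (f : ℕ → ℝ) : ℝ :=
  (∑ s, f (E s)) / 2 ^ n

section energyMean

variable (E : (Fin n → Bool) → ℕ) {f g : ℕ → ℝ}

theorem energyMean_mono (h : ∀ s, f (E s) ≤ g (E s)) : energyMean E f ≤ energyMean E g := by
  unfold energyMean
  gcongr with s
  exact h s

theorem energyMean_congr (h : ∀ s, f (E s) = g (E s)) : energyMean E f = energyMean E g :=
  le_antisymm (energyMean_mono E fun s => (h s).le) (energyMean_mono E fun s => (h s).ge)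

theorem energyMean_add :
    energyMean E (fun e => f e + g e) = energyMean E f + energyMean E g := by
  simp only [energyMean, Finset.sum_add_distrib, add_div]

theorem energyMean_sub :
    energyMean E (fun e => f e - g e) = energyMean E f - energyMean E g := by
  simp only [energyMean, Finset.sum_sub_distrib, sub_div]

theorem energyMean_const_mul (a : ℝ) :
    energyMean E (fun e => a * f e) = a * energyMean E f := by
  simp only [energyMean, ← Finset.mul_sum, mul_div_assoc]

@[simp]
theorem energyMean_const (a : ℝ) : energyMean E (fun _ => a) = a := by
  simp [energyMean]

theorem energyMean_nonneg (h : ∀ s, 0 ≤ f (E s)) : 0 ≤ energyMean E f := by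
  simpa using energyMean_mono E (f := fun _ => 0) h

theorem energyMean_pos (h : ∀ s, 0 < f (E s)) : 0 < energyMean E f := by
  unfold energyMean
  have : 0 < ∑ s, f (E s) := Finset.sum_pos (fun s _ => h s) Finset.univ_nonempty
  positivity

variable {E}

theorem hasDerivAt_energyMean {F : ℝ → ℕ → ℝ} {x : ℝ}
    (h : ∀ s, HasDerivAt (fun t => F t (E s)) (f (E s)) x) :
    HasDerivAt (fun t => energyMean E (F t)) (energyMean E f) x := by
  unfold energyMean
  exact (HasDerivAt.fun_sum fun s _ => h s).div_const _

theorem contDiffAt_energyMean {k : WithTop ℕ∞} {F : ℝ → ℕ → ℝ} {x : ℝ}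
    (h : ∀ s, ContDiffAt ℝ k (fun t => F t (E s)) x) :
    ContDiffAt ℝ k (fun t => energyMean E (F t)) x := by
  unfold energyMean
  exact (ContDiffAt.sum fun s _ => h s).div_const _

end energyMean

/-- The fraction `N₀ / N` of the bit strings that have energy `0`. -/
def solutionFraction (E : (Fin n → Bool) → ℕ) : ℝ :=
  energyMean E fun e => if e = 0 then 1 else 0

theorem solutionFraction_eq (E : (Fin n → Bool) → ℕ) :
    solutionFraction E = numSolutions E / 2 ^ n := by
  simp [solutionFraction, energyMean, numSolutions]

theorem solutionFraction_pos {E : (Fin n → Bool) → ℕ} (h0 : 0 < numSolutions E) :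
    0 < solutionFraction E := by
  rw [solutionFraction_eq]; positivity

theorem solutionFraction_le_one (E : (Fin n → Bool) → ℕ) : solutionFraction E ≤ 1 := by
  rw [← energyMean_const E 1]
  refine energyMean_mono E fun s => ?_
  split_ifs <;> norm_num

/-! ### The secular equation -/

/-- The secular equation of the ground level: `H(z)` has the eigenvalue `-z / t` when
`secularGround E t = z`. -/
def secularGround (E : (Fin n → Bool) → ℕ) (t : ℝ) : ℝ :=
  energyMean E fun e => t / (1 + e * t)

/-- The parameters `t` for which all the denominators in `secularGround` are positive; this open set
contains all `t ≥ 0`. -/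
def groundDomain (E : (Fin n → Bool) → ℕ) : Set ℝ :=
  {t | ∀ s, 0 < 1 + (E s : ℝ) * t}

/-- The values of `secularGround`, an open set that contains all `z ≥ 0`. Working on it rather than
on `z ≥ 0` makes two-sided derivatives available at `z = 0`. -/
def groundRange (E : (Fin n → Bool) → ℕ) : Set ℝ :=
  secularGround E '' groundDomain E

/-- The secular equation of the first excited level: `H(z)` has the eigenvalue `z * u` when
`secularExcited E u = z`. -/
def secularExcited (E : (Fin n → Bool) → ℕ) (u : ℝ) : ℝ :=
  energyMean E fun e => 1 / (e - u)

/-- The interval between `0` and the least positive energy. -/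
def excitedDomain (E : (Fin n → Bool) → ℕ) : Set ℝ :=
  {u | 0 < u ∧ ∀ s, E s ≠ 0 → u < E s}

/-- The solution `t` of `secularGround E t = z`, so that the ground level of `H(z)` is `-z / t`. -/
def groundParam (E : (Fin n → Bool) → ℕ) (z : ℝ) : ℝ :=
  Function.invFunOn (secularGround E) (groundDomain E) z

/-- The solution `u` of `secularExcited E u = z`, so that the first excited level of `H(z)`
is `z * u`. -/
def excitedParam (E : (Fin n → Bool) → ℕ) (z : ℝ) : ℝ :=
  Function.invFunOn (secularExcited E) (excitedDomain E) z

/-- The depth `x = -λ₀(z)` of the ground level, written as a function that is smooth also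
at `z = 0`. -/
def groundDepth (E : (Fin n → Bool) → ℕ) (z : ℝ) : ℝ :=
  energyMean E fun e => 1 / (1 + e * groundParam E z)

/-- The spectral gap in terms of the solutions of the secular equation. Unlike `gap E`, it is smooth
in a neighbourhood of `z = 0`. -/
def secularGap (E : (Fin n → Bool) → ℕ) (z : ℝ) : ℝ :=
  groundDepth E z + z * excitedParam E z

section secular

variable {E : (Fin n → Bool) → ℕ}

theorem isOpen_groundDomain : IsOpen (groundDomain E) := by
  simp only [groundDomain, ofPred_forall]
  exact isOpen_iInter_of_finite fun s => isOpen_lt (by fun_prop) (by fun_prop)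

theorem isOpen_excitedDomain : IsOpen (excitedDomain E) := by
  have : excitedDomain E = Ioi 0 ∩ ⋂ s, {u : ℝ | E s ≠ 0 → u < E s} := by
    ext u; simp [excitedDomain]
  rw [this]
  refine isOpen_Ioi.inter (isOpen_iInter_of_finite fun s => ?_)
  by_cases h : E s = 0
  · simp [h]
  · simp only [h, ne_eq, not_false_eq_true, forall_const]
    exact isOpen_Iio

theorem mem_groundDomain {t : ℝ} (ht : 0 ≤ t) : t ∈ groundDomain E := fun s => by positivity

theorem sub_ne_zero_of_mem_excitedDomain {u : ℝ} (hu : u ∈ excitedDomain E)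
    (s : Fin n → Bool) : (E s : ℝ) - u ≠ 0 := by
  by_cases h : E s = 0
  · simp [h, hu.1.ne']
  · exact (sub_pos.2 (hu.2 s h)).ne'

theorem secularGround_injOn : InjOn (secularGround E) (groundDomain E) := by
  intro t ht r hr h
  have h1 : (t - r) * energyMean E (fun e => 1 / ((1 + e * t) * (1 + e * r))) = 0 := by
    rw [← energyMean_const_mul, ← sub_eq_zero.2 h, secularGround, secularGround, ← energyMean_sub]
    refine energyMean_congr E fun s => ?_
    have h1 := (ht s).ne'
    have h2 := (hr s).ne'
    rw [div_sub_div _ _ h1 h2, mul_one_div]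
    ring
  have h2 : 0 < energyMean E (fun e => 1 / ((1 + e * t) * (1 + e * r))) :=
    energyMean_pos E fun s => one_div_pos.2 (mul_pos (ht s) (hr s))
  exact sub_eq_zero.1 ((mul_eq_zero.1 h1).resolve_right h2.ne')

theorem secularExcited_injOn : InjOn (secularExcited E) (excitedDomain E) := by
  intro t ht r hr h
  have h1 : (t - r) * energyMean E (fun e => 1 / ((e - t) * (e - r))) = 0 := by
    rw [← energyMean_const_mul, ← sub_eq_zero.2 h, secularExcited, secularExcited,
      ← energyMean_sub]
    refine energyMean_congr E fun s => ?_
    have := sub_ne_zero_of_mem_excitedDomain ht s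
    have := sub_ne_zero_of_mem_excitedDomain hr s
    field_simp
    ring
  have h2 : 0 < energyMean E (fun e => 1 / ((e - t) * (e - r))) := by
    refine energyMean_pos E fun s => one_div_pos.2 ?_
    by_cases h : E s = 0
    · simpa [h] using mul_pos ht.1 hr.1
    · exact mul_pos (sub_pos.2 (ht.2 s h)) (sub_pos.2 (hr.2 s h))
  exact sub_eq_zero.1 ((mul_eq_zero.1 h1).resolve_right h2.ne')

theorem hasDerivAt_secularGround {t : ℝ} (ht : t ∈ groundDomain E) :
    HasDerivAt (secularGround E) (energyMean E fun e => 1 / (1 + e * t) ^ 2) t := by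
  refine hasDerivAt_energyMean fun s => ?_
  have h := (ht s).ne'
  refine (HasDerivAt.fun_div (hasDerivAt_id' t)
    (((hasDerivAt_id' t).const_mul (E s : ℝ)).const_add 1) h).congr_deriv ?_
  ring

theorem hasDerivAt_secularExcited {u : ℝ} (hu : u ∈ excitedDomain E) :
    HasDerivAt (secularExcited E) (energyMean E fun e => 1 / (e - u) ^ 2) u := by
  refine hasDerivAt_energyMean fun s => ?_
  have h := sub_ne_zero_of_mem_excitedDomain hu s
  refine (HasDerivAt.fun_div (hasDerivAt_const u (1 : ℝ))
    ((hasDerivAt_id' u).const_sub (E s : ℝ)) h).congr_deriv ?_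
  ring

theorem contDiffAt_secularGround {t : ℝ} (ht : t ∈ groundDomain E) {k : WithTop ℕ∞} :
    ContDiffAt ℝ k (secularGround E) t :=
  contDiffAt_energyMean fun s =>
    contDiffAt_id.div (contDiffAt_const.add (contDiffAt_const.mul contDiffAt_id)) (ht s).ne'

theorem contDiffAt_secularExcited {u : ℝ} (hu : u ∈ excitedDomain E) {k : WithTop ℕ∞} :
    ContDiffAt ℝ k (secularExcited E) u :=
  contDiffAt_energyMean fun s =>
    contDiffAt_const.div (contDiffAt_const.sub contDiffAt_id)
      (sub_ne_zero_of_mem_excitedDomain hu s)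

theorem energyMean_inv_sq_pos_of_mem_groundDomain {t : ℝ} (ht : t ∈ groundDomain E) :
    0 < energyMean E fun e => 1 / (1 + e * t) ^ 2 :=
  energyMean_pos E fun s => one_div_pos.2 (pow_pos (ht s) 2)

theorem energyMean_inv_sq_pos_of_mem_excitedDomain {u : ℝ} (hu : u ∈ excitedDomain E) :
    0 < energyMean E fun e => 1 / (e - u) ^ 2 :=
  energyMean_pos E fun s => one_div_pos.2 (by
    have := sub_ne_zero_of_mem_excitedDomain hu s
    positivity)

theorem exists_secularGround_eq (h0 : 0 < numSolutions E) {z : ℝ} (hz : 0 ≤ z) :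
    ∃ t, 0 ≤ t ∧ secularGround E t = z := by
  have hp := solutionFraction_pos h0
  set b := z / solutionFraction E with hb
  have hb0 : 0 ≤ b := by positivity
  have hc : ContinuousOn (secularGround E) (Icc 0 b) := fun t ht =>
    ((contDiffAt_secularGround (k := 0) (mem_groundDomain ht.1)).continuousAt).continuousWithinAt
  have h1 : secularGround E 0 = 0 := by simp [secularGround]
  have h2 : z ≤ secularGround E b := by
    have : z = b * solutionFraction E := by rw [hb]; field_simp
    rw [this, solutionFraction, ← energyMean_const_mul]
    refine energyMean_mono E fun s => ?_
    split_ifs with h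
    · simp [h]
    · rw [mul_zero]; positivity
  obtain ⟨t, ht, h⟩ := intermediate_value_Icc hb0 hc ⟨h1.trans_le hz, h2⟩
  exact ⟨t, ht.1, h⟩

/-- On the interval below the least positive energy, `secularExcited` runs from `-∞` to `∞`. -/
theorem exists_secularExcited_eq (h0 : 0 < numSolutions E) (h1 : ∃ s, E s ≠ 0) {z : ℝ}
    (hz : 0 ≤ z) : ∃ u ∈ excitedDomain E, secularExcited E u = z := by
  obtain ⟨s₁, hs₁, hmin⟩ := Finset.exists_min_image (Finset.univ.filter fun s => E s ≠ 0) E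
    (h1.imp fun s hs => by simpa using hs)
  simp only [Finset.mem_filter, Finset.mem_univ, true_and] at hs₁ hmin
  have hp := solutionFraction_pos h0
  have hp1 := solutionFraction_le_one E
  have he : (1 : ℝ) ≤ E s₁ := by exact_mod_cast Nat.one_le_iff_ne_zero.2 hs₁
  have hN : (1 : ℝ) ≤ 2 ^ n := one_le_pow₀ (by norm_num)
  -- At `a` the solutions contribute `-2`; at `b` one nearby pole contributes `z + 2`.
  set a := solutionFraction E / 2 with ha
  set δ : ℝ := 1 / (2 ^ n * (z + 2)) with hδ
  have hδ0 : 0 < δ := by positivity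
  have hδ1 : δ ≤ 1 / 2 := by
    rw [hδ]
    apply one_div_le_one_div_of_le (by norm_num)
    nlinarith
  set b := (E s₁ : ℝ) - δ with hb
  have hab : a ≤ b := by linarith
  have hsub : Icc a b ⊆ excitedDomain E := fun u hu =>
    ⟨by linarith [hu.1], fun s hs => by
      have : (E s₁ : ℝ) ≤ E s := by exact_mod_cast hmin s hs
      linarith [hu.2]⟩
  have hc : ContinuousOn (secularExcited E) (Icc a b) := fun u hu =>
    ((contDiffAt_secularExcited (k := 0) (hsub hu)).continuousAt).continuousWithinAt
  have hza : secularExcited E a ≤ z := by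
    have : secularExcited E a ≤ 2 - (1 / a) * solutionFraction E := by
      rw [solutionFraction, ← energyMean_const_mul, ← energyMean_const E 2, ← energyMean_sub]
      refine energyMean_mono E fun s => ?_
      by_cases h : E s = 0
      · simp only [h, CharP.cast_eq_zero, zero_sub, if_true, mul_one]
        rw [one_div_neg_eq_neg_one_div]
        linarith
      · have h3 : (1 : ℝ) ≤ E s := by exact_mod_cast Nat.one_le_iff_ne_zero.2 h
        simp only [h, if_false, mul_zero, sub_zero]
        rw [div_le_iff₀ (by linarith)]
        linarith
    have h4 : (1 / a) * solutionFraction E = 2 := by rw [ha]; field_simp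
    linarith
  have hzb : z ≤ secularExcited E b := by
    have : secularExcited E b + 2 =
        energyMean E fun e => 1 / (e - b) + 2 := by
      rw [energyMean_add, energyMean_const, secularExcited]
    suffices z + 2 ≤ secularExcited E b + 2 by linarith
    rw [this, energyMean]
    have hnn : ∀ s ∈ Finset.univ, 0 ≤ 1 / ((E s : ℝ) - b) + 2 := by
      intro s _
      by_cases h : E s = 0
      · have : 1 / b ≤ 2 := by
          rw [div_le_iff₀ (by linarith)]; linarith
        simp only [h, CharP.cast_eq_zero, zero_sub]
        rw [one_div_neg_eq_neg_one_div]
        linarith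
      · have : (E s₁ : ℝ) ≤ E s := by exact_mod_cast hmin s h
        have : 0 < (E s : ℝ) - b := by linarith
        positivity
    have h5 := Finset.single_le_sum hnn (Finset.mem_univ s₁)
    rw [le_div_iff₀ (by positivity)]
    refine le_trans ?_ h5
    have : (E s₁ : ℝ) - b = δ := by rw [hb]; ring
    rw [this, hδ, one_div_one_div]
    linarith
  obtain ⟨u, hu, h⟩ := intermediate_value_Icc hab hc ⟨hza, hzb⟩
  exact ⟨u, hsub hu, h⟩

theorem groundParam_eq {t z : ℝ} (ht : t ∈ groundDomain E) (h : secularGround E t = z) :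
    groundParam E z = t := by
  subst h
  exact secularGround_injOn.leftInvOn_invFunOn ht

theorem excitedParam_eq {u z : ℝ} (hu : u ∈ excitedDomain E) (h : secularExcited E u = z) :
    excitedParam E z = u := by
  subst h
  exact secularExcited_injOn.leftInvOn_invFunOn hu

theorem groundParam_nonneg (h0 : 0 < numSolutions E) {z : ℝ} (hz : 0 ≤ z) :
    0 ≤ groundParam E z := by
  obtain ⟨t, ht, h⟩ := exists_secularGround_eq h0 hz
  rwa [groundParam_eq (mem_groundDomain ht) h]

theorem mem_groundRange (h0 : 0 < numSolutions E) {z : ℝ} (hz : 0 ≤ z) : z ∈ groundRange E := by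
  obtain ⟨t, ht, h⟩ := exists_secularGround_eq h0 hz
  exact ⟨t, mem_groundDomain ht, h⟩

theorem excitedParam_mem (h0 : 0 < numSolutions E) (h1 : ∃ s, E s ≠ 0) {z : ℝ} (hz : 0 ≤ z) :
    excitedParam E z ∈ excitedDomain E := by
  obtain ⟨u, hu, h⟩ := exists_secularExcited_eq h0 h1 hz
  rwa [excitedParam_eq hu h]

theorem secularExcited_excitedParam (h0 : 0 < numSolutions E) (h1 : ∃ s, E s ≠ 0) {z : ℝ}
    (hz : 0 ≤ z) : secularExcited E (excitedParam E z) = z := by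
  obtain ⟨u, hu, h⟩ := exists_secularExcited_eq h0 h1 hz
  rwa [excitedParam_eq hu h]

theorem groundParam_mem {z : ℝ} (hz : z ∈ groundRange E) : groundParam E z ∈ groundDomain E :=
  Function.invFunOn_mem hz

theorem secularGround_groundParam {z : ℝ} (hz : z ∈ groundRange E) :
    secularGround E (groundParam E z) = z :=
  Function.invFunOn_eq hz

theorem isOpen_groundRange : IsOpen (groundRange E) := by
  rw [isOpen_iff_mem_nhds]
  rintro z ⟨t, ht, rfl⟩
  exact image_mem_nhds_of_hasDerivAt isOpen_groundDomain ht (contDiffAt_secularGround ht)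
    (hasDerivAt_secularGround ht) (energyMean_inv_sq_pos_of_mem_groundDomain ht).ne'

theorem contDiffAt_groundParam {z : ℝ} (hz : z ∈ groundRange E) {k : WithTop ℕ∞}
    (hk : k ≠ 0) : ContDiffAt ℝ k (groundParam E) z := by
  have ht := groundParam_mem hz
  have := contDiffAt_invFunOn hk isOpen_groundDomain secularGround_injOn ht
    (contDiffAt_secularGround ht) (hasDerivAt_secularGround ht)
    (energyMean_inv_sq_pos_of_mem_groundDomain ht).ne'
  rwa [secularGround_groundParam hz] at this

theorem contDiffAt_excitedParam (h0 : 0 < numSolutions E) (h1 : ∃ s, E s ≠ 0) {z : ℝ}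
    (hz : 0 ≤ z) {k : WithTop ℕ∞} (hk : k ≠ 0) : ContDiffAt ℝ k (excitedParam E) z := by
  have hu := excitedParam_mem h0 h1 hz
  have := contDiffAt_invFunOn hk isOpen_excitedDomain secularExcited_injOn hu
    (contDiffAt_secularExcited hu) (hasDerivAt_secularExcited hu)
    (energyMean_inv_sq_pos_of_mem_excitedDomain hu).ne'
  rwa [secularExcited_excitedParam h0 h1 hz] at this

theorem hasDerivAt_groundParam {z : ℝ} (hz : z ∈ groundRange E) :
    HasDerivAt (groundParam E) (energyMean E fun e => 1 / (1 + e * groundParam E z) ^ 2)⁻¹ z := by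
  have ht := groundParam_mem hz
  have := hasDerivAt_invFunOn isOpen_groundDomain secularGround_injOn ht
    (contDiffAt_secularGround ht) (hasDerivAt_secularGround ht)
    (energyMean_inv_sq_pos_of_mem_groundDomain ht).ne'
  rwa [secularGround_groundParam hz] at this

theorem hasDerivAt_excitedParam (h0 : 0 < numSolutions E) (h1 : ∃ s, E s ≠ 0) {z : ℝ}
    (hz : 0 ≤ z) :
    HasDerivAt (excitedParam E) (energyMean E fun e => 1 / (e - excitedParam E z) ^ 2)⁻¹ z := by
  have hu := excitedParam_mem h0 h1 hz
  have := hasDerivAt_invFunOn isOpen_excitedDomain secularExcited_injOn hu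
    (contDiffAt_secularExcited hu) (hasDerivAt_secularExcited hu)
    (energyMean_inv_sq_pos_of_mem_excitedDomain hu).ne'
  rwa [secularExcited_excitedParam h0 h1 hz] at this

theorem contDiffAt_groundDepth {z : ℝ} (hz : z ∈ groundRange E) {k : WithTop ℕ∞}
    (hk : k ≠ 0) : ContDiffAt ℝ k (groundDepth E) z :=
  contDiffAt_energyMean fun s =>
    contDiffAt_const.div (contDiffAt_const.add (contDiffAt_const.mul
      (contDiffAt_groundParam hz hk))) (groundParam_mem hz s).ne'

theorem contDiffAt_secularGap (h0 : 0 < numSolutions E) (h1 : ∃ s, E s ≠ 0) {z : ℝ}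
    (hz : 0 ≤ z) {k : WithTop ℕ∞} (hk : k ≠ 0) : ContDiffAt ℝ k (secularGap E) z :=
  (contDiffAt_groundDepth (mem_groundRange h0 hz) hk).add (contDiffAt_id.mul (contDiffAt_excitedParam h0 h1 hz hk))

theorem groundDepth_pos {z : ℝ} (hz : z ∈ groundRange E) : 0 < groundDepth E z :=
  energyMean_pos E fun s => one_div_pos.2 (groundParam_mem hz s)

theorem groundDepth_mul_groundParam {z : ℝ} (hz : z ∈ groundRange E) :
    groundDepth E z * groundParam E z = z := by
  conv_rhs => rw [← secularGround_groundParam hz]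
  rw [mul_comm, groundDepth, secularGround, ← energyMean_const_mul]
  simp only [mul_one_div]

/-- The derivative of the depth `-λ₀` is, up to sign, the mean energy of the ground state. -/
theorem hasDerivAt_groundDepth (h0 : 0 < numSolutions E) {m : ℕ} (hm : ∀ s, E s ≤ m) {z : ℝ}
    (hz : 0 ≤ z) : ∃ l ∈ Icc (0 : ℝ) m, HasDerivAt (groundDepth E) (-l) z := by
  have ht := mem_groundDomain (E := E) (groundParam_nonneg h0 hz)
  set t := groundParam E z with htdef
  set K := energyMean E fun e => 1 / (1 + e * t) ^ 2 with hK
  have hKpos : 0 < K := energyMean_inv_sq_pos_of_mem_groundDomain ht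
  refine ⟨(energyMean E fun e => e * (1 / (1 + e * t) ^ 2)) * K⁻¹, ⟨?_, ?_⟩, ?_⟩
  · have := energyMean_nonneg E (f := fun e => e * (1 / (1 + e * t) ^ 2)) fun s => by positivity
    positivity
  · rw [← div_eq_mul_inv, div_le_iff₀ hKpos, hK, ← energyMean_const_mul]
    refine energyMean_mono E fun s => ?_
    have : (E s : ℝ) ≤ m := by exact_mod_cast hm s
    gcongr
  · have hX : HasDerivAt (fun r => energyMean E fun e => 1 / (1 + e * r))
        (energyMean E fun e => -1 * (e * (1 / (1 + e * t) ^ 2))) t := by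
      refine hasDerivAt_energyMean fun s => ?_
      have h := (ht s).ne'
      refine (HasDerivAt.fun_div (hasDerivAt_const t (1 : ℝ))
        (((hasDerivAt_id' t).const_mul (E s : ℝ)).const_add 1) h).congr_deriv ?_
      ring
    have := hX.comp z (hasDerivAt_groundParam (mem_groundRange h0 hz))
    rw [energyMean_const_mul] at this
    exact this.congr_deriv (by ring)

/-- The derivative of `λ₁` is the mean energy of the first excited state. -/
theorem hasDerivAt_excitedLevel (h0 : 0 < numSolutions E) (h1 : ∃ s, E s ≠ 0) {m : ℕ}
    (hm : ∀ s, E s ≤ m) {z : ℝ} (hz : 0 ≤ z) :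
    ∃ l ∈ Icc (0 : ℝ) m, HasDerivAt (fun z => z * excitedParam E z) l z := by
  have hu := excitedParam_mem h0 h1 hz
  have hd := (hasDerivAt_id z).mul (hasDerivAt_excitedParam h0 h1 hz)
  have hG := secularExcited_excitedParam h0 h1 hz
  set u := excitedParam E z with hudef
  set K := energyMean E fun e => 1 / (e - u) ^ 2 with hK
  have hKpos : 0 < K := energyMean_inv_sq_pos_of_mem_excitedDomain hu
  refine ⟨(energyMean E fun e => e * (1 / (e - u) ^ 2)) * K⁻¹, ⟨?_, ?_⟩, ?_⟩
  · have := energyMean_nonneg E (f := fun e => e * (1 / (e - u) ^ 2)) fun s => by positivity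
    positivity
  · rw [← div_eq_mul_inv, div_le_iff₀ hKpos, hK, ← energyMean_const_mul]
    refine energyMean_mono E fun s => ?_
    have : (E s : ℝ) ≤ m := by exact_mod_cast hm s
    gcongr
  · have h2 : (energyMean E fun e => e * (1 / (e - u) ^ 2)) = z + u * K := by
      rw [hK, ← hG, secularExcited, ← energyMean_const_mul, ← energyMean_add]
      refine energyMean_congr E fun s => ?_
      have := sub_ne_zero_of_mem_excitedDomain hu s
      field_simp
      ring
    refine hd.congr_deriv ?_
    rw [h2]
    simp only [id, one_mul]
    field_simp
    ring

theorem exists_hasDerivAt_secularGap (h0 : 0 < numSolutions E) (h1 : ∃ s, E s ≠ 0) {m : ℕ}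
    (hm : ∀ s, E s ≤ m) {z : ℝ} (hz : 0 ≤ z) :
    ∃ l : ℝ, |l| ≤ m ∧ HasDerivAt (secularGap E) l z := by
  obtain ⟨a, ha, hda⟩ := hasDerivAt_groundDepth h0 hm hz
  obtain ⟨b, hb, hdb⟩ := hasDerivAt_excitedLevel h0 h1 hm hz
  exact ⟨-a + b, abs_le.2 ⟨by linarith [ha.2, hb.1], by linarith [ha.1, hb.2]⟩, hda.add hdb⟩

end secular

/-! ### Lower bounds on the gap -/

/-- The mean `Z₁ = N⁻¹ ∑_{E(s) > 0} E(s)⁻¹`, close to which the gap is smallest. The bit strings of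
energy `0` contribute nothing, because `0⁻¹ = 0`. -/
def invEnergyMean (E : (Fin n → Bool) → ℕ) : ℝ :=
  energyMean E fun e => (e : ℝ)⁻¹

section gapBound

variable {E : (Fin n → Bool) → ℕ}

theorem one_le_cast_energy {s : Fin n → Bool} (h : E s ≠ 0) : (1 : ℝ) ≤ E s := by
  exact_mod_cast Nat.one_le_iff_ne_zero.2 h

theorem invEnergyMean_nonneg : 0 ≤ invEnergyMean E := energyMean_nonneg E fun s => by positivity

theorem invEnergyMean_le_one : invEnergyMean E ≤ 1 := by
  rw [← energyMean_const E 1]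
  refine energyMean_mono E fun s => ?_
  by_cases h : E s = 0
  · simp [h]
  · exact inv_le_one_of_one_le₀ (one_le_cast_energy h)

theorem solutionFraction_le_groundDepth (h0 : 0 < numSolutions E) {z : ℝ} (hz : 0 ≤ z) :
    solutionFraction E ≤ groundDepth E z := by
  have ht := groundParam_nonneg h0 hz
  refine energyMean_mono E fun s => ?_
  split_ifs with h
  · simp [h]
  · positivity

theorem excitedLevel_nonneg (h0 : 0 < numSolutions E) (h1 : ∃ s, E s ≠ 0) {z : ℝ} (hz : 0 ≤ z) :
    0 ≤ z * excitedParam E z :=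
  mul_nonneg hz (excitedParam_mem h0 h1 hz).1.le

theorem secularGap_pos (h0 : 0 < numSolutions E) (h1 : ∃ s, E s ≠ 0) {z : ℝ} (hz : 0 ≤ z) :
    0 < secularGap E z :=
  add_pos_of_pos_of_nonneg (groundDepth_pos (mem_groundRange h0 hz)) (excitedLevel_nonneg h0 h1 hz)

/-- To the left of `Z₁` the ground level alone keeps the gap open, to the right of `Z₁` the first
excited level does. -/
theorem abs_sub_le_secularGap (h0 : 0 < numSolutions E) (h1 : ∃ s, E s ≠ 0) {z : ℝ} (hz : 0 ≤ z) :
    |z - invEnergyMean E| ≤ secularGap E z := by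
  have hy := excitedLevel_nonneg h0 h1 hz
  rw [abs_le]
  constructor
  · have ht := groundParam_nonneg h0 hz
    have hS := secularGround_groundParam (mem_groundRange h0 hz)
    have : invEnergyMean E - z ≤ groundDepth E z := by
      conv_lhs => rw [← hS]
      rw [invEnergyMean, secularGround, ← energyMean_sub]
      refine energyMean_mono E fun s => ?_
      by_cases h : E s = 0
      · simp only [h, CharP.cast_eq_zero, inv_zero, zero_mul, add_zero, div_one]
        linarith
      · have he := one_le_cast_energy h
        set t := groundParam E z
        have h2 : (E s : ℝ)⁻¹ - t / (1 + E s * t) = (E s : ℝ)⁻¹ * (1 / (1 + E s * t)) := by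
          field_simp
          ring
        rw [h2]
        exact mul_le_of_le_one_left (by positivity) (inv_le_one_of_one_le₀ he)
    unfold secularGap
    linarith
  · have hu := excitedParam_mem h0 h1 hz
    have hG := secularExcited_excitedParam h0 h1 hz
    have hp := solutionFraction_le_groundDepth h0 hz
    set u := excitedParam E z with hudef
    have : z - invEnergyMean E ≤ u * secularExcited E u + solutionFraction E := by
      conv_lhs => rw [← hG]
      rw [invEnergyMean, secularExcited, ← energyMean_sub, ← energyMean_const_mul,
        solutionFraction, ← energyMean_add]
      refine energyMean_mono E fun s => ?_
      by_cases h : E s = 0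
      · simp only [h, CharP.cast_eq_zero, inv_zero, zero_sub, sub_zero, if_true]
        have := hu.1
        have h3 : u * (1 / -u) = -1 := by field_simp
        rw [h3, one_div_neg_eq_neg_one_div]
        have : 0 < 1 / u := by positivity
        linarith
      · have he := one_le_cast_energy h
        have hlt := sub_pos.2 (hu.2 s h)
        simp only [h, if_false, add_zero]
        have h2 : 1 / ((E s : ℝ) - u) - (E s : ℝ)⁻¹ = (E s : ℝ)⁻¹ * (u * (1 / (E s - u))) := by
          field_simp
          ring
        rw [h2]
        have := hu.1
        exact mul_le_of_le_one_left (by positivity) (inv_le_one_of_one_le₀ he)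
    rw [hG] at this
    unfold secularGap
    rw [← hudef]
    linarith

/-- The two levels repel each other: the product of the depth of the ground level and the
height of the first excited level is at least `z p₀ / 2`, unless the latter is above `z / 2`. This
comes from subtracting the secular equations of the two levels. -/
theorem solutionFraction_le_mul (h0 : 0 < numSolutions E) (h1 : ∃ s, E s ≠ 0) {z : ℝ}
    (hz : 0 ≤ z) (hu2 : excitedParam E z ≤ 1 / 2) :
    solutionFraction E ≤ 2 * groundDepth E z * excitedParam E z := by
  have hu := excitedParam_mem h0 h1 hz
  have hG := secularExcited_excitedParam h0 h1 hz
  have ht := groundParam_nonneg h0 hz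
  have hS := secularGround_groundParam (mem_groundRange h0 hz)
  have hX : groundDepth E z = energyMean E fun e => 1 / (1 + e * groundParam E z) := rfl
  set t := groundParam E z
  set u := excitedParam E z
  have hu0 := hu.1
  have h2 : energyMean E (fun e => 1 / ((e - u) * (1 + e * t))) = 0 := by
    have : (1 + u * t) * energyMean E (fun e => 1 / ((e - u) * (1 + e * t))) = 0 := by
      rw [← energyMean_const_mul, ← sub_eq_zero.2 (hG.trans hS.symm), secularExcited,
        secularGround, ← energyMean_sub]
      refine energyMean_congr E fun s => ?_
      have := sub_ne_zero_of_mem_excitedDomain hu s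
      have h3 : 1 + (E s : ℝ) * t ≠ 0 := by positivity
      field_simp
      ring
    have h4 : 1 + u * t ≠ 0 := by positivity
    exact (mul_eq_zero.1 this).resolve_left h4
  have h5 : 0 ≤ 2 * groundDepth E z - u⁻¹ * solutionFraction E := by
    rw [← h2, hX, solutionFraction, ← energyMean_const_mul, ← energyMean_const_mul,
      ← energyMean_sub]
    refine energyMean_mono E fun s => ?_
    by_cases h : E s = 0
    · simp only [h, CharP.cast_eq_zero, zero_sub, zero_mul, add_zero, mul_one, if_true, div_one,
        one_div, inv_neg]
      linarith
    · have he := one_le_cast_energy h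
      simp only [h, if_false, mul_zero, sub_zero]
      have hpos : (0 : ℝ) < 1 + E s * t := by positivity
      rw [mul_one_div, div_le_div_iff₀ (mul_pos (by linarith) hpos) hpos]
      nlinarith
  rw [sub_nonneg, inv_mul_le_iff₀ hu0] at h5
  linarith

/-- The gap is at least of order `√p₀`. For `p₀ ≥ 1 / 2` the depth of the ground level suffices, for
`z` well below `Z₁` the bound `|z - Z₁|`, and near or above `Z₁` the level repulsion. -/
theorem sqrt_le_secularGap (h0 : 0 < numSolutions E) (h1 : ∃ s, E s ≠ 0) {m : ℕ}
    (hm : ∀ s, E s ≤ m) {z : ℝ} (hz : 0 ≤ z) :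
    Real.sqrt (solutionFraction E) / (8 * m) ≤ secularGap E z := by
  have hm1 : (1 : ℝ) ≤ m := by
    obtain ⟨s, hs⟩ := h1
    exact_mod_cast (Nat.one_le_iff_ne_zero.2 hs).trans (hm s)
  have hp := solutionFraction_pos h0
  have hp1 := solutionFraction_le_one E
  set r := Real.sqrt (solutionFraction E) with hr
  have hr0 : 0 ≤ r := Real.sqrt_nonneg _
  have hrr : r * r = solutionFraction E := Real.mul_self_sqrt hp.le
  have hr1 : r ≤ 1 := by nlinarith
  have hx := solutionFraction_le_groundDepth h0 hz
  have hy := excitedLevel_nonneg h0 h1 hz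
  have habs := abs_sub_le_secularGap h0 h1 hz
  have hgx : groundDepth E z + z * excitedParam E z = secularGap E z := rfl
  rw [div_le_iff₀ (by positivity)]
  rcases le_or_gt (1 / 2) (solutionFraction E) with hcase | hcase
  · nlinarith
  -- At most half of the bit strings are solutions, so that `Z₁ ≥ 1 / (2 m)`.
  have hA : 1 / 2 ≤ m * invEnergyMean E := by
    have : 1 - solutionFraction E ≤ m * invEnergyMean E := by
      rw [← energyMean_const E 1, solutionFraction, ← energyMean_sub, invEnergyMean,
        ← energyMean_const_mul]
      refine energyMean_mono E fun s => ?_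
      by_cases h : E s = 0
      · simp [h]
      · have he := one_le_cast_energy h
        have : (E s : ℝ) ≤ m := by exact_mod_cast hm s
        simp only [h, if_false, sub_zero]
        rw [← div_eq_mul_inv, le_div_iff₀ (by linarith)]
        linarith
    linarith
  set A := invEnergyMean E
  rcases lt_or_ge z (A / 2) with hzA | hzA
  · have : A - z ≤ secularGap E z := by
      have := neg_abs_le (z - A); linarith
    nlinarith
  rcases le_or_gt (excitedParam E z) (1 / 2) with hu | hu
  · have h2 := solutionFraction_le_mul h0 h1 hz hu
    set x := groundDepth E z
    set u := excitedParam E z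
    have h3 : z * (r * r) ≤ 2 * (x * (z * u)) := by
      rw [hrr]; nlinarith
    have h4 : 2 * (x * (z * u)) ≤ secularGap E z ^ 2 := by
      rw [← hgx]; nlinarith [sq_nonneg (x - z * u), sq_nonneg x, sq_nonneg (z * u)]
    have h5 : 1 ≤ 4 * (m * z) := by nlinarith
    refine abs_le_of_sq_le_sq' ?_ (by have := secularGap_pos h0 h1 hz; positivity) |>.2
    have h6 : (r * r) ≤ 4 * m * secularGap E z ^ 2 := by nlinarith [mul_nonneg hr0 hr0]
    nlinarith [sq_nonneg (secularGap E z), mul_nonneg (sub_nonneg.2 hm1) (sq_nonneg (secularGap E z))]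
  · have h2 : z / 2 ≤ secularGap E z := by
      have := groundDepth_pos (mem_groundRange h0 hz)
      nlinarith
    nlinarith

end gapBound

/-! ### The Hamiltonian in coordinates -/

/-- The vector whose amplitude at `|s⟩` is the real number `f (E s)`. -/
def ofEnergy (E : (Fin n → Bool) → ℕ) (f : ℕ → ℝ) : Qubits n :=
  WithLp.toLp 2 fun s => (f (E s) : ℂ)

section hamiltonian

variable {E : (Fin n → Bool) → ℕ} {f g : ℕ → ℝ}

@[simp]
theorem ofEnergy_apply (s : Fin n → Bool) : ofEnergy E f s = f (E s) := rfl

theorem ofEnergy_mem : ofEnergy E f ∈ symmetricSubspace E := fun s t h => by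
  simp [h]

theorem inner_ofEnergy :
    inner ℂ (ofEnergy E f) (ofEnergy E g) = ((∑ s, f (E s) * g (E s) : ℝ) : ℂ) := by
  simp only [PiLp.inner_apply, ofEnergy_apply, RCLike.inner_apply, Complex.conj_ofReal]
  push_cast
  exact Finset.sum_congr rfl fun s _ => mul_comm _ _

theorem targetHamiltonian_apply (v : Qubits n) (s : Fin n → Bool) :
    targetHamiltonian E v s = E s * v s := by
  simp [targetHamiltonian, Matrix.mulVec_diagonal]

theorem mixingHamiltonian_apply (v : Qubits n) (s : Fin n → Bool) :
    mixingHamiltonian n v s = -((∑ t, v t) / 2 ^ n) := by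
  have h : ((Real.sqrt (2 ^ n) : ℝ) : ℂ) * ((Real.sqrt (2 ^ n) : ℝ) : ℂ) = 2 ^ n := by
    rw [← Complex.ofReal_mul, Real.mul_self_sqrt (by positivity)]
    push_cast
    rfl
  simp only [mixingHamiltonian, _root_.neg_apply, InnerProductSpace.rankOne_apply,
    uniformState, PiLp.inner_apply, RCLike.inner_apply, PiLp.neg_apply, PiLp.smul_apply,
    smul_eq_mul, Complex.conj_ofReal, ← Finset.sum_mul]
  rw [← h]
  push_cast
  field_simp

theorem hamiltonian_apply (z : ℝ) (v : Qubits n) (s : Fin n → Bool) :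
    hamiltonian E z v s = z * (E s * v s) - (∑ t, v t) / 2 ^ n := by
  simp only [hamiltonian, _root_.add_apply, _root_.smul_apply,
    PiLp.add_apply, PiLp.smul_apply, targetHamiltonian_apply, mixingHamiltonian_apply, smul_eq_mul]
  ring

theorem hamiltonian_ofEnergy (z : ℝ) :
    hamiltonian E z (ofEnergy E f) = ofEnergy E fun e => z * (e * f e) - energyMean E f := by
  ext s
  rw [hamiltonian_apply]
  simp [energyMean]

theorem isSymmetric_hamiltonian (E : (Fin n → Bool) → ℕ) (z : ℝ) :
    (hamiltonian E z : Qubits n →ₗ[ℂ] Qubits n).IsSymmetric := by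
  intro v w
  simp only [ContinuousLinearMap.coe_coe, PiLp.inner_apply, RCLike.inner_apply, hamiltonian_apply,
    map_sub, map_mul, map_div₀, map_sum, map_pow, map_natCast, Complex.conj_ofReal, map_ofNat,
    mul_sub, sub_mul, Finset.sum_sub_distrib, ← Finset.mul_sum, ← Finset.sum_mul]
  congr 1
  · exact Finset.sum_congr rfl fun s _ => by ring
  · ring

theorem hamiltonian_mem_symmetricSubspace (z : ℝ) {v : Qubits n} (hv : v ∈ symmetricSubspace E) :
    hamiltonian E z v ∈ symmetricSubspace E := fun s t h => by
  rw [hamiltonian_apply, hamiltonian_apply, h, hv s t h]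

/-- An eigenvector of `H(z)` solves a diagonal equation whose right-hand side is a constant. -/
theorem eq_of_hamiltonian_eq {z μ : ℝ} {v : Qubits n} (h : hamiltonian E z v = (μ : ℂ) • v)
    (s : Fin n → Bool) : ((z * E s - μ : ℝ) : ℂ) * v s = (∑ t, v t) / 2 ^ n := by
  have := congrArg (fun w : Qubits n => w s) h
  simp only [hamiltonian_apply, PiLp.smul_apply, smul_eq_mul] at this
  push_cast
  linear_combination this

/-- Eigenvalues that do not lie on the diagonal of `z H_f` solve the secular equation. -/
theorem energyMean_eq_one_of_hamiltonian_eq {z μ : ℝ} {v : Qubits n} (hv : v ≠ 0)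
    (h : hamiltonian E z v = (μ : ℂ) • v) (hne : ∀ s, z * E s - μ ≠ 0) :
    energyMean E (fun e => 1 / (z * e - μ)) = 1 ∧
      ∀ s, v s = (∑ t, v t) / 2 ^ n * ((1 / (z * E s - μ) : ℝ) : ℂ) := by
  have h1 := eq_of_hamiltonian_eq h
  set k : ℂ := (∑ t, v t) / 2 ^ n with hk
  have h2 : ∀ s, v s = k * ((1 / (z * E s - μ) : ℝ) : ℂ) := by
    intro s
    have h3 : ((z * E s - μ : ℝ) : ℂ) ≠ 0 := by exact_mod_cast hne s
    rw [← h1 s]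
    rw [Complex.ofReal_div, Complex.ofReal_one]
    field_simp
  have hk0 : k ≠ 0 := by
    intro h0
    apply hv
    ext s
    rw [h2 s, h0]
    simp
  refine ⟨?_, h2⟩
  have h4 : k = k * ((energyMean E (fun e => 1 / (z * e - μ)) : ℝ) : ℂ) := by
    conv_lhs => rw [hk, Finset.sum_congr rfl fun s _ => h2 s, ← Finset.mul_sum]
    simp only [energyMean]
    push_cast
    ring
  have h5 := mul_left_cancel₀ hk0 ((mul_one k).trans h4)
  exact_mod_cast h5.symm

end hamiltonian

/-! ### The two lowest levels -/

section levels

variable {E : (Fin n → Bool) → ℕ}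

theorem one_add_mul_groundParam {z : ℝ} (hz : z ∈ groundRange E) (s : Fin n → Bool) :
    z * E s + groundDepth E z = groundDepth E z * (1 + E s * groundParam E z) := by
  linear_combination -(E s : ℝ) * groundDepth_mul_groundParam hz

/-- An unnormalized ground state of `H(z)` in the symmetric subspace. -/
theorem hamiltonian_ground {t z : ℝ} (ht : t ∈ groundDomain E) (hS : secularGround E t = z) :
    hamiltonian E z (ofEnergy E fun e => 1 / (1 + e * t)) =
      ((-energyMean E (fun e => 1 / (1 + e * t)) : ℝ) : ℂ) •
        ofEnergy E fun e => 1 / (1 + e * t) := by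
  have hz : z = energyMean E (fun e => 1 / (1 + e * t)) * t := by
    rw [← hS, mul_comm, secularGround, ← energyMean_const_mul]
    simp only [mul_one_div]
  rw [hamiltonian_ofEnergy]
  ext s
  simp only [ofEnergy_apply, PiLp.smul_apply, smul_eq_mul]
  generalize energyMean E (fun e => 1 / (1 + e * t)) = x at hz ⊢
  rw [← Complex.ofReal_mul, hz]
  congr 1
  linear_combination x * mul_one_div_cancel (ht s).ne'

/-- An eigenvector of the first excited level, valid also at `z = 0`. -/
theorem hamiltonian_excited (h0 : 0 < numSolutions E) (h1 : ∃ s, E s ≠ 0) {z : ℝ} (hz : 0 ≤ z) :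
    hamiltonian E z (ofEnergy E fun e => 1 / (e - excitedParam E z)) =
      ((z * excitedParam E z : ℝ) : ℂ) • ofEnergy E fun e => 1 / (e - excitedParam E z) := by
  have hu := excitedParam_mem h0 h1 hz
  have hG := secularExcited_excitedParam h0 h1 hz
  rw [secularExcited] at hG
  rw [hamiltonian_ofEnergy, hG]
  ext s
  simp only [ofEnergy_apply, PiLp.smul_apply, smul_eq_mul]
  rw [← Complex.ofReal_mul]
  congr 1
  have := sub_ne_zero_of_mem_excitedDomain hu s
  field_simp
  ring

theorem ofEnergy_ne_zero {f : ℕ → ℝ} {s : Fin n → Bool} (h : f (E s) ≠ 0) : ofEnergy E f ≠ 0 := by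
  intro h2
  have := congrArg (fun w : Qubits n => w s) h2
  simp [h] at this

/-- The ground level is simple, even on the whole space. -/
theorem eq_smul_of_hamiltonian_eq_groundDepth (h0 : 0 < numSolutions E) {z : ℝ} (hz : 0 ≤ z)
    {v : Qubits n} (hv : v ≠ 0) (h : hamiltonian E z v = ((-groundDepth E z : ℝ) : ℂ) • v) :
    ∃ k : ℂ, v = k • ofEnergy E fun e => 1 / (1 + e * groundParam E z) := by
  have hx := groundDepth_pos (mem_groundRange h0 hz)
  have ht := mem_groundDomain (E := E) (groundParam_nonneg h0 hz)
  have hne : ∀ s, z * E s - -groundDepth E z ≠ 0 := fun s => by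
    rw [sub_neg_eq_add]; positivity
  obtain ⟨-, h2⟩ := energyMean_eq_one_of_hamiltonian_eq hv h hne
  refine ⟨(∑ t, v t) / 2 ^ n / groundDepth E z, ?_⟩
  ext s
  rw [h2 s]
  simp only [PiLp.smul_apply, ofEnergy_apply, smul_eq_mul]
  rw [sub_neg_eq_add, one_add_mul_groundParam (mem_groundRange h0 hz)]
  have h3 : (groundDepth E z : ℂ) ≠ 0 := by exact_mod_cast hx.ne'
  push_cast
  field_simp

/-- No eigenvalue of `H(z)` on the whole space is below the ground level. -/
theorem neg_groundDepth_le (h0 : 0 < numSolutions E) {z : ℝ} (hz : 0 ≤ z) {ν : ℝ} {w : Qubits n}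
    (hw : w ≠ 0) (h : hamiltonian E z w = (ν : ℂ) • w) : -groundDepth E z ≤ ν := by
  by_contra! hlt
  have hx := groundDepth_pos (mem_groundRange h0 hz)
  have hpos : ∀ s, 0 < z * E s - ν := fun s => by
    have : 0 ≤ z * E s := by positivity
    linarith
  have hpos' : ∀ s, 0 < z * E s + groundDepth E z := fun s => by positivity
  obtain ⟨h1, -⟩ := energyMean_eq_one_of_hamiltonian_eq hw h fun s => (hpos s).ne'
  have h2 : energyMean E (fun e => 1 / (z * e + groundDepth E z)) = 1 := by
    rw [energyMean_congr E (g := fun e => (groundDepth E z)⁻¹ * (1 / (1 + e * groundParam E z)))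
      fun s => ?_, energyMean_const_mul]
    · exact inv_mul_cancel₀ hx.ne'
    · rw [one_add_mul_groundParam (mem_groundRange h0 hz)]
      have := (mem_groundDomain (E := E) (groundParam_nonneg h0 hz) s).ne'
      field_simp
  have h4 : 0 < energyMean E (fun e => 1 / (z * e + groundDepth E z) - 1 / (z * e - ν)) :=
    energyMean_pos E fun s => sub_pos.2 (one_div_lt_one_div_of_lt (hpos' s) (by linarith))
  rw [energyMean_sub, h1, h2] at h4
  linarith

/-- Every symmetric eigenvalue other than the ground level is at least the first excited level. -/
theorem excitedLevel_le (h0 : 0 < numSolutions E) (h1 : ∃ s, E s ≠ 0) {z : ℝ} (hz : 0 ≤ z)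
    {μ : ℝ} (hμ : μ ∈ symmetricLevels E z) (hne : μ ≠ -groundDepth E z) :
    z * excitedParam E z ≤ μ := by
  obtain ⟨v, hvs, hv, h⟩ := hμ
  by_contra! hlt
  have hu := excitedParam_mem h0 h1 hz
  have hx := groundDepth_pos (mem_groundRange h0 hz)
  obtain ⟨s₀, hs₀⟩ : ∃ s, E s = 0 := by
    obtain ⟨s, hs⟩ := Finset.card_pos.1 h0
    exact ⟨s, by simpa using hs⟩
  by_cases hoff : ∀ s, z * E s - μ ≠ 0
  · -- Off the diagonal `μ` solves the secular equation, and its only solution below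
    -- the first excited level is the ground level.
    obtain ⟨hsec, -⟩ := energyMean_eq_one_of_hamiltonian_eq hv h hoff
    rcases hz.eq_or_lt with rfl | hzpos
    · have h2 : groundDepth E 0 = 1 := by
        have : groundParam E 0 = 0 :=
          groundParam_eq (mem_groundDomain le_rfl) (by simp [secularGround])
        simp [groundDepth, this]
      simp only [zero_mul, zero_sub, energyMean_const] at hsec
      have h3 : μ ≠ 0 := by simpa using hoff s₀
      rw [h2] at hne
      apply hne
      field_simp at hsec
      linarith
    · have h4 : secularExcited E (μ / z) = z := by
        have : z = z * 1 := by ring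
        conv_rhs => rw [this, ← hsec, ← energyMean_const_mul]
        refine energyMean_congr E fun s => ?_
        have h5 := hoff s
        have h6 : (E s : ℝ) - μ / z ≠ 0 := by
          intro h7
          apply h5
          field_simp at h7
          linarith
        field_simp
      have hμ0 : μ ≠ 0 := by
        have := hoff s₀
        rw [hs₀] at this
        simpa using this
      rcases lt_or_gt_of_ne hμ0 with hneg | hpos
      · have ht : 0 < z / -μ := div_pos hzpos (by linarith)
        have h5 : secularGround E (z / -μ) = z := by
          conv_rhs => rw [← h4]
          refine energyMean_congr E fun s => ?_
          have h7 := hoff s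
          have h9 : (0 : ℝ) ≤ E s * z := by positivity
          have h6 : (E s : ℝ) - μ / z ≠ 0 := by
            have : μ / z < 0 := div_neg_of_neg_of_pos hneg hzpos
            have : (0 : ℝ) ≤ E s := by positivity
            linarith
          have h8 : 1 + (E s : ℝ) * (z / -μ) ≠ 0 := (mem_groundDomain ht.le s).ne'
          rw [div_eq_div_iff h8 h6]
          field_simp
          ring
        have h6 := groundParam_eq (mem_groundDomain ht.le) h5
        have h7 := groundDepth_mul_groundParam (mem_groundRange h0 hz)
        rw [h6] at h7
        apply hne
        field_simp at h7
        linarith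
      · have hlt' : μ / z < excitedParam E z := by
          rw [div_lt_iff₀ hzpos]
          linarith
        have hmem : μ / z ∈ excitedDomain E :=
          ⟨by positivity, fun s hs => hlt'.trans (hu.2 s hs)⟩
        rw [excitedParam_eq hmem h4] at hlt'
        exact lt_irrefl _ hlt'
  · -- If `μ` is a diagonal entry below the first excited level, it is the entry `0`.
    push Not at hoff
    obtain ⟨s₁, hs₁⟩ := hoff
    have hzero : z * E s₁ = 0 := by
      by_contra hcon
      have h2 : E s₁ ≠ 0 := by
        intro h3
        apply hcon
        simp [h3]
      have := hu.2 s₁ h2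
      nlinarith
    have hμ0 : μ = 0 := by linarith
    subst hμ0
    rcases hz.eq_or_lt with rfl | hzpos
    · simp at hlt
    have hk : (∑ t, v t) / 2 ^ n = 0 := by
      rw [← eq_of_hamiltonian_eq h s₀, hs₀]
      simp
    have hvan : ∀ s, E s ≠ 0 → v s = 0 := by
      intro s hs
      have h3 := eq_of_hamiltonian_eq h s
      rw [hk, mul_eq_zero] at h3
      refine h3.resolve_left ?_
      simpa using ⟨hzpos.ne', hs⟩
    have hsum : ∑ t, v t = numSolutions E * v s₀ := by
      rw [numSolutions, ← nsmul_eq_mul, ← Finset.sum_const, Finset.sum_filter]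
      refine Finset.sum_congr rfl fun s _ => ?_
      split_ifs with h3
      · exact hvs s s₀ (h3.trans hs₀.symm)
      · exact hvan s h3
    have hv0 : v s₀ = 0 := by
      have h3 : ∑ t, v t = 0 := by
        rw [div_eq_zero_iff] at hk
        exact hk.resolve_right (pow_ne_zero _ two_ne_zero)
      rw [hsum, mul_eq_zero] at h3
      exact h3.resolve_left (by exact_mod_cast h0.ne')
    apply hv
    ext s
    by_cases h3 : E s = 0
    · rw [hvs s s₀ (h3.trans hs₀.symm), hv0]; rfl
    · rw [hvan s h3]; rfl

theorem neg_groundDepth_mem (h0 : 0 < numSolutions E) {z : ℝ} (hz : 0 ≤ z) :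
    -groundDepth E z ∈ symmetricLevels E z := by
  have ht := mem_groundDomain (E := E) (groundParam_nonneg h0 hz)
  exact ⟨_, ofEnergy_mem, ofEnergy_ne_zero (s := fun _ => false) (one_div_pos.2 (ht _)).ne',
    hamiltonian_ground ht (secularGround_groundParam (mem_groundRange h0 hz))⟩

theorem excitedLevel_mem (h0 : 0 < numSolutions E) (h1 : ∃ s, E s ≠ 0) {z : ℝ} (hz : 0 ≤ z) :
    z * excitedParam E z ∈ symmetricLevels E z :=
  ⟨_, ofEnergy_mem, ofEnergy_ne_zero (s := fun _ => false) (one_div_ne_zero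
    (sub_ne_zero_of_mem_excitedDomain (excitedParam_mem h0 h1 hz) _)),
    hamiltonian_excited h0 h1 hz⟩

theorem level₀_eq (h0 : 0 < numSolutions E) {z : ℝ} (hz : 0 ≤ z) :
    level₀ E z = -groundDepth E z := by
  refine IsLeast.csInf_eq ⟨neg_groundDepth_mem h0 hz, ?_⟩
  rintro μ ⟨v, -, hv, h⟩
  exact neg_groundDepth_le h0 hz hv h

theorem level₁_eq (h0 : 0 < numSolutions E) (h1 : ∃ s, E s ≠ 0) {z : ℝ} (hz : 0 ≤ z) :
    level₁ E z = z * excitedParam E z := by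
  rw [level₁, level₀_eq h0 hz]
  refine IsLeast.csInf_eq ⟨⟨excitedLevel_mem h0 h1 hz, ?_⟩, ?_⟩
  · have := groundDepth_pos (mem_groundRange h0 hz)
    have := excitedLevel_nonneg h0 h1 hz
    simp only [mem_singleton_iff]
    linarith
  · rintro μ ⟨hμ, hne⟩
    exact excitedLevel_le h0 h1 hz hμ hne

theorem gap_eq_secularGap (h0 : 0 < numSolutions E) (h1 : ∃ s, E s ≠ 0) {z : ℝ} (hz : 0 ≤ z) :
    gap E z = secularGap E z := by
  rw [gap, level₀_eq h0 hz, level₁_eq h0 h1 hz, secularGap]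
  ring

/-- The spectral theorem: a lower bound on the spectrum of `T + d` bounds `T + d` from below. -/
theorem mul_norm_le_of_isSymmetric {F : Type*} [NormedAddCommGroup F] [InnerProductSpace ℂ F]
    [FiniteDimensional ℂ F] {T : F →ₗ[ℂ] F} (hT : T.IsSymmetric) {c d : ℝ} (hc : 0 ≤ c)
    (h : ∀ (μ : ℝ) (v : F), v ≠ 0 → T v = (μ : ℂ) • v → c ≤ μ + d) (y : F) :
    c * ‖y‖ ≤ ‖T y + (d : ℂ) • y‖ := by
  let b := hT.eigenvectorBasis rfl
  have hTb : ∀ i, T (b i) = (hT.eigenvalues rfl i : ℂ) • b i := fun i =>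
    hT.apply_eigenvectorBasis rfl i
  have hcoord : ∀ i, inner ℂ (b i) (T y + (d : ℂ) • y) =
      ((hT.eigenvalues rfl i + d : ℝ) : ℂ) * inner ℂ (b i) y := by
    intro i
    rw [inner_add_right, ← hT, hTb, inner_smul_left, inner_smul_right, Complex.conj_ofReal]
    push_cast
    ring
  have hsq : (c * ‖y‖) ^ 2 ≤ ‖T y + (d : ℂ) • y‖ ^ 2 := by
    rw [mul_pow, ← b.sum_sq_norm_inner_right, ← b.sum_sq_norm_inner_right, Finset.mul_sum]
    refine Finset.sum_le_sum fun i _ => ?_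
    rw [hcoord, norm_mul, mul_pow, Complex.norm_real, Real.norm_eq_abs, sq_abs]
    gcongr
    exact h _ _ (b.orthonormal.ne_zero i) (hTb i)
  exact (abs_le_of_sq_le_sq' hsq (norm_nonneg _)).2

/-- The gap bounds `H(z) - λ₀(z)` from below on the symmetric vectors orthogonal to the
ground state. -/
theorem secularGap_mul_norm_le (h0 : 0 < numSolutions E) (h1 : ∃ s, E s ≠ 0) {z : ℝ} (hz : 0 ≤ z)
    {w : Qubits n} (hw : w ∈ symmetricSubspace E)
    (hort : inner ℂ (ofEnergy E fun e => 1 / (1 + e * groundParam E z)) w = 0) :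
    secularGap E z * ‖w‖ ≤ ‖hamiltonian E z w + (groundDepth E z : ℂ) • w‖ := by
  set a := ofEnergy E fun e => 1 / (1 + e * groundParam E z) with ha
  have ht := mem_groundDomain (E := E) (groundParam_nonneg h0 hz)
  have hHa : hamiltonian E z a = ((-groundDepth E z : ℝ) : ℂ) • a :=
    hamiltonian_ground ht (secularGround_groundParam (mem_groundRange h0 hz))
  have ha0 : a ≠ 0 := ofEnergy_ne_zero (s := fun _ => false) (one_div_pos.2 (ht _)).ne'
  have hsymm := isSymmetric_hamiltonian E z
  let W : Submodule ℂ (Qubits n) := symmetricSubspace E ⊓ (ℂ ∙ a)ᗮ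
  have hmemW : ∀ {y : Qubits n}, y ∈ W ↔ y ∈ symmetricSubspace E ∧ inner ℂ a y = 0 := by
    intro y
    rw [Submodule.mem_inf, Submodule.mem_orthogonal_singleton_iff_inner_right]
  have hinv : ∀ y ∈ W, (hamiltonian E z : Qubits n →ₗ[ℂ] Qubits n) y ∈ W := by
    intro y hy
    rw [hmemW] at hy ⊢
    refine ⟨hamiltonian_mem_symmetricSubspace z hy.1, ?_⟩
    rw [← hsymm, ContinuousLinearMap.coe_coe, hHa, inner_smul_left, hy.2, mul_zero]
  have hT := hsymm.restrict_invariant hinv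
  refine mul_norm_le_of_isSymmetric hT (secularGap_pos h0 h1 hz).le (fun μ v hv0 hTv => ?_)
    ⟨w, hmemW.2 ⟨hw, hort⟩⟩
  have hv := hmemW.1 v.2
  have hv0' : (v : Qubits n) ≠ 0 := by simpa using hv0
  have hHv : hamiltonian E z v = (μ : ℂ) • (v : Qubits n) := congrArg Subtype.val hTv
  have hne : μ ≠ -groundDepth E z := by
    rintro rfl
    obtain ⟨k, hk⟩ := eq_smul_of_hamiltonian_eq_groundDepth h0 hz hv0' hHv
    have h3 := hv.2
    rw [hk, ← ha, inner_smul_right, mul_eq_zero, inner_self_eq_zero] at h3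
    rcases h3 with h3 | h3
    · rw [hk, h3, zero_smul] at hv0'
      exact hv0' rfl
    · exact ha0 h3
  have := excitedLevel_le h0 h1 hz ⟨_, hv.1, hv0', hHv⟩ hne
  rw [secularGap]
  linarith

end levels

/-! ### The ground state along the path and its derivatives -/

/-- The real amplitudes of the normalized ground state of `H(z)` as a function of the energy. -/
def groundAmp (E : (Fin n → Bool) → ℕ) (z : ℝ) (e : ℕ) : ℝ :=
  1 / (1 + e * groundParam E z) / Real.sqrt (∑ s, (1 / (1 + E s * groundParam E z)) ^ 2)

/-- The derivative in `z` of `groundAmp`. -/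
def groundAmpDeriv (E : (Fin n → Bool) → ℕ) (z : ℝ) (e : ℕ) : ℝ :=
  deriv (fun y => groundAmp E y e) z

/-- The normalized ground state `v` of `H(z)`, with positive amplitudes. -/
def groundVec (E : (Fin n → Bool) → ℕ) (z : ℝ) : Qubits n :=
  ofEnergy E (groundAmp E z)

/-- The diagonal resolvent `(z H_f - λ₀)⁻¹` applied to the derivative of the ground state. -/
def preCorrectorAmp (E : (Fin n → Bool) → ℕ) (z : ℝ) (e : ℕ) : ℝ :=
  1 / (1 + e * groundParam E z) / groundDepth E z * groundAmpDeriv E z e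

/-- The amplitudes of the vector `w` orthogonal to the ground state `v` with
`(H(z) - λ₀) w = dv/dz`. Since `H(z) - λ₀` differs from `z H_f - λ₀` by a rank-one term that vanishes
here, `w` is the diagonal resolvent applied to `dv/dz`, projected away from `v`. -/
def correctorAmp (E : (Fin n → Bool) → ℕ) (z : ℝ) (e : ℕ) : ℝ :=
  preCorrectorAmp E z e - (∑ s, groundAmp E z (E s) * preCorrectorAmp E z (E s)) * groundAmp E z e

/-- The operator `H(z) - λ₀(z)`. -/
def shiftedHamiltonian (E : (Fin n → Bool) → ℕ) (z : ℝ) : Qubits n →L[ℂ] Qubits n :=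
  hamiltonian E z + (groundDepth E z : ℂ) • 1

/-- The derivative `H_f - λ₀'(z)` of `H(z) - λ₀(z)`. -/
def centeredTarget (E : (Fin n → Bool) → ℕ) (z : ℝ) : Qubits n →L[ℂ] Qubits n :=
  targetHamiltonian E + ((deriv (groundDepth E) z : ℝ) : ℂ) • 1

theorem contDiffAt_deriv_infty {f : ℝ → ℝ} {x : ℝ} (h : ContDiffAt ℝ (⊤ : ℕ∞) f x) :
    ContDiffAt ℝ (⊤ : ℕ∞) (deriv f) x := by
  have := (h.fderiv_right (m := (⊤ : ℕ∞)) (by simp)).clm_apply (contDiffAt_const (c := (1 : ℝ)))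
  exact this.congr_of_eventuallyEq (Filter.Eventually.of_forall fun y => by simp)

section groundState

variable {E : (Fin n → Bool) → ℕ}

theorem hasDerivAt_ofEnergy {f : ℝ → ℕ → ℝ} {f' : ℕ → ℝ} {z : ℝ}
    (h : ∀ s, HasDerivAt (fun y => f y (E s)) (f' (E s)) z) :
    HasDerivAt (fun y => ofEnergy E (f y)) (ofEnergy E f') z := by
  have h1 : HasDerivAt (fun y => fun s => ((f y (E s) : ℝ) : ℂ)) (fun s => ((f' (E s) : ℝ) : ℂ)) z :=
    hasDerivAt_pi.2 fun s => (h s).ofReal_comp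
  exact (PiLp.continuousLinearEquiv 2 ℝ fun _ : Fin n → Bool =>
    ℂ).symm.toContinuousLinearMap.hasFDerivAt.comp_hasDerivAt z h1

theorem sum_sq_pos {z : ℝ} (hz : z ∈ groundRange E) :
    0 < ∑ s, (1 / (1 + (E s : ℝ) * groundParam E z)) ^ 2 :=
  Finset.sum_pos (fun s _ => pow_pos (one_div_pos.2 (groundParam_mem hz s)) 2)
    Finset.univ_nonempty

theorem contDiffAt_unnormalizedAmp {z : ℝ} (hz : z ∈ groundRange E) (s : Fin n → Bool) :
    ContDiffAt ℝ (⊤ : ℕ∞) (fun y => 1 / (1 + (E s : ℝ) * groundParam E y)) z :=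
  contDiffAt_const.div (contDiffAt_const.add (contDiffAt_const.mul
      (contDiffAt_groundParam hz (by simp)))) (groundParam_mem hz s).ne'

theorem contDiffAt_groundAmp {z : ℝ} (hz : z ∈ groundRange E) (s : Fin n → Bool) :
    ContDiffAt ℝ (⊤ : ℕ∞) (fun y => groundAmp E y (E s)) z := by
  refine (contDiffAt_unnormalizedAmp hz s).div (ContDiffAt.sqrt ?_ (sum_sq_pos hz).ne')
    (Real.sqrt_pos.2 (sum_sq_pos hz)).ne'
  exact ContDiffAt.sum fun r _ => (contDiffAt_unnormalizedAmp hz r).pow 2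

theorem contDiffAt_groundAmpDeriv {z : ℝ} (hz : z ∈ groundRange E) (s : Fin n → Bool) :
    ContDiffAt ℝ (⊤ : ℕ∞) (fun y => groundAmpDeriv E y (E s)) z :=
  contDiffAt_deriv_infty (contDiffAt_groundAmp hz s)

theorem contDiffAt_correctorAmp {z : ℝ} (hz : z ∈ groundRange E) (s : Fin n → Bool) :
    ContDiffAt ℝ (⊤ : ℕ∞) (fun y => correctorAmp E y (E s)) z := by
  have h1 : ∀ r, ContDiffAt ℝ (⊤ : ℕ∞) (fun y => preCorrectorAmp E y (E r)) z := fun r =>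
    ((contDiffAt_unnormalizedAmp hz r).div (contDiffAt_groundDepth hz (by simp))
      (groundDepth_pos hz).ne').mul (contDiffAt_groundAmpDeriv hz r)
  exact (h1 s).sub ((ContDiffAt.sum fun r _ => (contDiffAt_groundAmp hz r).mul (h1 r)).mul
    (contDiffAt_groundAmp hz s))

theorem hasDerivAt_groundVec {z : ℝ} (hz : z ∈ groundRange E) :
    HasDerivAt (groundVec E) (ofEnergy E (groundAmpDeriv E z)) z :=
  hasDerivAt_ofEnergy fun s => ((contDiffAt_groundAmp hz s).differentiableAt (by simp)).hasDerivAt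

theorem sum_groundAmp_sq {z : ℝ} (hz : z ∈ groundRange E) :
    ∑ s, groundAmp E z (E s) * groundAmp E z (E s) = 1 := by
  have h := sum_sq_pos hz
  simp only [groundAmp, ← sq, div_pow _ (Real.sqrt _), Real.sq_sqrt h.le, ← Finset.sum_div]
  exact div_self h.ne'

theorem sum_groundAmp_mul_deriv {z : ℝ} (hz : z ∈ groundRange E) :
    ∑ s, groundAmp E z (E s) * groundAmpDeriv E z (E s) = 0 := by
  have hd : ∀ s, HasDerivAt (fun y => groundAmp E y (E s)) (groundAmpDeriv E z (E s)) z := fun s =>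
    ((contDiffAt_groundAmp hz s).differentiableAt (by simp)).hasDerivAt
  have h1 := HasDerivAt.fun_sum (u := Finset.univ) fun s _ => (hd s).fun_mul (hd s)
  have h2 : HasDerivAt (fun y => ∑ s, groundAmp E y (E s) * groundAmp E y (E s)) 0 z := by
    refine (hasDerivAt_const z (1 : ℝ)).congr_of_eventuallyEq ?_
    filter_upwards [isOpen_groundRange.mem_nhds hz] with y hy
    exact sum_groundAmp_sq hy
  have h3 := h1.unique h2
  have h4 : ∀ s, groundAmpDeriv E z (E s) * groundAmp E z (E s) +
      groundAmp E z (E s) * groundAmpDeriv E z (E s) =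
      2 * (groundAmp E z (E s) * groundAmpDeriv E z (E s)) := fun s => by ring
  simp only [h4, ← Finset.mul_sum] at h3
  linarith

theorem norm_groundVec {z : ℝ} (hz : z ∈ groundRange E) : ‖groundVec E z‖ = 1 := by
  have h : inner ℂ (groundVec E z) (groundVec E z) = 1 := by
    rw [groundVec, inner_ofEnergy, sum_groundAmp_sq hz, Complex.ofReal_one]
  rw [norm_eq_sqrt_re_inner (𝕜 := ℂ), h]
  simp

theorem groundVec_eq_smul (z : ℝ) : groundVec E z =
    (((Real.sqrt (∑ s, (1 / (1 + E s * groundParam E z)) ^ 2))⁻¹ : ℝ) : ℂ) •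
      ofEnergy E fun e => 1 / (1 + e * groundParam E z) := by
  ext s
  simp only [groundVec, ofEnergy_apply, PiLp.smul_apply, smul_eq_mul, groundAmp]
  rw [← Complex.ofReal_mul, div_eq_inv_mul]

theorem hamiltonian_groundVec {z : ℝ} (hz : z ∈ groundRange E) :
    hamiltonian E z (groundVec E z) = ((-groundDepth E z : ℝ) : ℂ) • groundVec E z := by
  rw [groundVec_eq_smul, map_smul, hamiltonian_ground (groundParam_mem hz)
    (secularGround_groundParam hz), smul_comm]
  rfl

theorem shiftedHamiltonian_apply (z : ℝ) (v : Qubits n) :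
    shiftedHamiltonian E z v = hamiltonian E z v + (groundDepth E z : ℂ) • v := rfl

theorem centeredTarget_apply (z : ℝ) (v : Qubits n) :
    centeredTarget E z v = targetHamiltonian E v + ((deriv (groundDepth E) z : ℝ) : ℂ) • v := rfl

theorem shiftedHamiltonian_groundVec {z : ℝ} (hz : z ∈ groundRange E) :
    shiftedHamiltonian E z (groundVec E z) = 0 := by
  rw [shiftedHamiltonian_apply, hamiltonian_groundVec hz, ← add_smul]
  simp

theorem inner_shiftedHamiltonian {z : ℝ} (v w : Qubits n) :
    inner ℂ (shiftedHamiltonian E z v) w = inner ℂ v (shiftedHamiltonian E z w) := by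
  have := isSymmetric_hamiltonian E z v w
  simp only [ContinuousLinearMap.coe_coe] at this
  rw [shiftedHamiltonian_apply, shiftedHamiltonian_apply, inner_add_left, inner_add_right, this,
    inner_smul_left, inner_smul_right, Complex.conj_ofReal]

theorem groundVec_zero (E : (Fin n → Bool) → ℕ) : groundVec E 0 = uniformState n := by
  have : groundParam E 0 = 0 :=
    groundParam_eq (mem_groundDomain le_rfl) (by simp [secularGround])
  ext s
  simp [groundVec, groundAmp, this, uniformState]

theorem inner_groundVec_deriv {z : ℝ} (hz : z ∈ groundRange E) :
    inner ℂ (groundVec E z) (ofEnergy E (groundAmpDeriv E z)) = 0 := by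
  rw [groundVec, inner_ofEnergy, sum_groundAmp_mul_deriv hz, Complex.ofReal_zero]

theorem inner_groundVec_corrector {z : ℝ} (hz : z ∈ groundRange E) :
    inner ℂ (groundVec E z) (ofEnergy E (correctorAmp E z)) = 0 := by
  rw [groundVec, inner_ofEnergy, Complex.ofReal_eq_zero]
  simp only [correctorAmp, mul_sub, Finset.sum_sub_distrib]
  rw [sub_eq_zero]
  generalize (∑ s, groundAmp E z (E s) * preCorrectorAmp E z (E s)) = k
  rw [← mul_one k, ← sum_groundAmp_sq hz, Finset.mul_sum]
  refine Finset.sum_congr rfl fun s _ => ?_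
  rw [← Finset.mul_sum, sum_groundAmp_sq hz]
  ring

theorem shiftedHamiltonian_corrector {z : ℝ} (hz : z ∈ groundRange E) :
    shiftedHamiltonian E z (ofEnergy E (correctorAmp E z)) = ofEnergy E (groundAmpDeriv E z) := by
  have hsplit : ofEnergy E (correctorAmp E z) = ofEnergy E (preCorrectorAmp E z) -
      ((∑ s, groundAmp E z (E s) * preCorrectorAmp E z (E s) : ℝ) : ℂ) • groundVec E z := by
    ext s
    simp only [ofEnergy_apply, correctorAmp, PiLp.sub_apply, PiLp.smul_apply, groundVec,
      smul_eq_mul]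
    push_cast
    rfl
  rw [hsplit, map_sub, map_smul, shiftedHamiltonian_groundVec hz, smul_zero, sub_zero]
  have hx := groundDepth_pos hz
  have hmean : energyMean E (preCorrectorAmp E z) = 0 := by
    have h1 : energyMean E (preCorrectorAmp E z) =
        (Real.sqrt (∑ s, (1 / (1 + E s * groundParam E z)) ^ 2) / groundDepth E z) *
          energyMean E (fun e => groundAmp E z e * groundAmpDeriv E z e) := by
      rw [← energyMean_const_mul]
      refine energyMean_congr E fun s => ?_
      have := (Real.sqrt_pos.2 (sum_sq_pos hz)).ne'
      rw [preCorrectorAmp, groundAmp]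
      generalize Real.sqrt (∑ s, (1 / (1 + E s * groundParam E z)) ^ 2) = q at this
      field_simp
    rw [h1, energyMean, sum_groundAmp_mul_deriv hz]
    simp
  rw [shiftedHamiltonian_apply, hamiltonian_ofEnergy, hmean]
  ext s
  simp only [ofEnergy_apply, PiLp.add_apply, PiLp.smul_apply, smul_eq_mul, sub_zero]
  rw [← Complex.ofReal_mul, ← Complex.ofReal_add]
  congr 1
  have h1 := one_add_mul_groundParam hz s
  have h2 := (groundParam_mem hz s).ne'
  calc z * (E s * preCorrectorAmp E z (E s)) + groundDepth E z * preCorrectorAmp E z (E s)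
      = (z * E s + groundDepth E z) * preCorrectorAmp E z (E s) := by ring
    _ = groundAmpDeriv E z (E s) := by
        rw [h1, preCorrectorAmp]
        field_simp

theorem hasDerivAt_shiftedHamiltonian {z : ℝ} (hz : z ∈ groundRange E) {Y : ℝ → Qubits n}
    {Y' : Qubits n} (hY : HasDerivAt Y Y' z) :
    HasDerivAt (fun y => shiftedHamiltonian E y (Y y))
      (shiftedHamiltonian E z Y' + centeredTarget E z (Y z)) z := by
  have hX : HasDerivAt (groundDepth E) (deriv (groundDepth E) z) z :=
    ((contDiffAt_groundDepth hz one_ne_zero).differentiableAt one_ne_zero).hasDerivAt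
  have h1 : HasDerivAt (fun y => mixingHamiltonian n (Y y)) (mixingHamiltonian n Y') z :=
    ((mixingHamiltonian n).restrictScalars ℝ).hasFDerivAt.comp_hasDerivAt z hY
  have h2 : HasDerivAt (fun y => targetHamiltonian E (Y y)) (targetHamiltonian E Y') z :=
    ((targetHamiltonian E).restrictScalars ℝ).hasFDerivAt.comp_hasDerivAt z hY
  have h3 := (h1.fun_add ((hasDerivAt_id' z).fun_smul h2)).fun_add (hX.fun_smul hY)
  refine (h3.congr_of_eventuallyEq (Filter.Eventually.of_forall fun y => ?_)).congr_deriv ?_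
  · simp [shiftedHamiltonian, hamiltonian]
  · simp only [shiftedHamiltonian, hamiltonian, centeredTarget, _root_.add_apply,
      _root_.smul_apply, one_apply_eq_self, Complex.coe_smul, one_smul]
    abel

theorem shiftedHamiltonian_deriv {z : ℝ} (hz : z ∈ groundRange E) :
    shiftedHamiltonian E z (ofEnergy E (groundAmpDeriv E z)) =
      -centeredTarget E z (groundVec E z) := by
  have h1 := hasDerivAt_shiftedHamiltonian hz (hasDerivAt_groundVec hz)
  have h2 : HasDerivAt (fun y => shiftedHamiltonian E y (groundVec E y)) 0 z := by
    refine (hasDerivAt_const z (0 : Qubits n)).congr_of_eventuallyEq ?_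
    filter_upwards [isOpen_groundRange.mem_nhds hz] with y hy
    exact shiftedHamiltonian_groundVec hy
  exact eq_neg_of_add_eq_zero_left (h1.unique h2)

theorem norm_targetHamiltonian_add_apply_le {m : ℕ} (hm : ∀ s, E s ≤ m) {l : ℝ}
    (hl : l ∈ Icc (0 : ℝ) m) (v : Qubits n) :
    ‖targetHamiltonian E v + ((-l : ℝ) : ℂ) • v‖ ≤ m * ‖v‖ := by
  refine abs_le_of_sq_le_sq' ?_ (by positivity) |>.2
  rw [mul_pow, EuclideanSpace.norm_sq_eq, EuclideanSpace.norm_sq_eq, Finset.mul_sum]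
  refine Finset.sum_le_sum fun s _ => ?_
  have h1 : (targetHamiltonian E v + ((-l : ℝ) : ℂ) • v) s = ((E s - l : ℝ) : ℂ) * v s := by
    simp only [PiLp.add_apply, PiLp.smul_apply, smul_eq_mul, targetHamiltonian_apply]
    push_cast
    ring
  rw [h1, norm_mul, mul_pow, Complex.norm_real, Real.norm_eq_abs]
  have h2 : |(E s : ℝ) - l| ≤ m := by
    have h3 : (E s : ℝ) ≤ m := by exact_mod_cast hm s
    have h4 : (0 : ℝ) ≤ E s := by positivity
    exact abs_le.2 ⟨by linarith [hl.2], by linarith [hl.1]⟩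
  gcongr

theorem norm_centeredTarget_apply_le (h0 : 0 < numSolutions E) {m : ℕ} (hm : ∀ s, E s ≤ m) {z : ℝ}
    (hz : 0 ≤ z) (v : Qubits n) : ‖centeredTarget E z v‖ ≤ m * ‖v‖ := by
  obtain ⟨l, hl, hd⟩ := hasDerivAt_groundDepth h0 hm hz
  rw [centeredTarget_apply, hd.deriv]
  exact norm_targetHamiltonian_add_apply_le hm hl v

/-- The reduced resolvent of `H(z)` at the ground level has norm at most `1 / g(z)`. The range of
`H(z) - λ₀` is orthogonal to `v`, so the component of the right-hand side along `v` can be discarded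
at will. -/
theorem secularGap_mul_norm_sub_le (h0 : 0 < numSolutions E) (h1 : ∃ s, E s ≠ 0) {z : ℝ}
    (hz : 0 ≤ z) {y : Qubits n} (hy : y ∈ symmetricSubspace E) (k : ℂ) :
    secularGap E z * ‖y - inner ℂ (groundVec E z) y • groundVec E z‖ ≤
      ‖shiftedHamiltonian E z y - k • groundVec E z‖ := by
  have hz' := mem_groundRange h0 hz
  set v := groundVec E z with hv
  have hHv : shiftedHamiltonian E z v = 0 := shiftedHamiltonian_groundVec hz'
  have hvs : v ∈ symmetricSubspace E := ofEnergy_mem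
  have hvv : inner ℂ v v = (1 : ℂ) := by
    rw [inner_self_eq_norm_sq_to_K, norm_groundVec hz']
    simp
  have h2 : inner ℂ v (y - inner ℂ v y • v) = 0 := by
    rw [inner_sub_right, inner_smul_right, hvv, mul_one, sub_self]
  have h3 : inner ℂ (ofEnergy E fun e => 1 / (1 + e * groundParam E z))
      (y - inner ℂ v y • v) = 0 := by
    generalize y - inner ℂ v y • v = y' at h2 ⊢
    rw [hv, groundVec_eq_smul, inner_smul_left, mul_eq_zero] at h2
    refine h2.resolve_left ?_
    have := (Real.sqrt_pos.2 (sum_sq_pos hz')).ne'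
    rw [Complex.conj_ofReal]
    exact_mod_cast inv_ne_zero this
  have h4 := secularGap_mul_norm_le h0 h1 hz
    (Submodule.sub_mem _ hy (Submodule.smul_mem _ (inner ℂ v y) hvs)) h3
  rw [← shiftedHamiltonian_apply, map_sub, map_smul, hHv, smul_zero, sub_zero] at h4
  refine h4.trans ?_
  set r := shiftedHamiltonian E z y with hr
  have h5 : inner ℂ r v = (0 : ℂ) := by
    rw [hr, inner_shiftedHamiltonian, hHv, inner_zero_right]
  have h6 : ‖r‖ * ‖r‖ ≤ ‖r‖ * ‖r - k • v‖ := by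
    calc ‖r‖ * ‖r‖ = ‖inner ℂ r r‖ := by
          rw [inner_self_eq_norm_sq_to_K]; simp [sq]
      _ = ‖inner ℂ r (r - k • v)‖ := by
          rw [inner_sub_right, inner_smul_right, h5, mul_zero, sub_zero]
      _ ≤ ‖r‖ * ‖r - k • v‖ := norm_inner_le_norm _ _
  rcases (norm_nonneg r).eq_or_lt with h7 | h7
  · rw [← h7]; exact norm_nonneg _
  · exact le_of_mul_le_mul_left h6 h7

/-- The norms of `dv/dz`, of the corrector `w` and of `dw/dz` are bounded by
`m / g`, `m / g²` and `4 m² / g³`. -/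
theorem exists_corrector_bounds (h0 : 0 < numSolutions E) (h1 : ∃ s, E s ≠ 0) {m : ℕ}
    (hm : ∀ s, E s ≤ m) {z : ℝ} (hz : 0 ≤ z) :
    ‖ofEnergy E (correctorAmp E z)‖ ≤ m / secularGap E z ^ 2 ∧
    ∃ W' : Qubits n, HasDerivAt (fun y => ofEnergy E (correctorAmp E y)) W' z ∧
      ‖W'‖ ≤ 4 * m ^ 2 / secularGap E z ^ 3 := by
  have hz' := mem_groundRange h0 hz
  have hg := secularGap_pos h0 h1 hz
  set g := secularGap E z
  have hnv := norm_groundVec hz'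
  have hiW := inner_groundVec_corrector hz'
  have hiV' := inner_groundVec_deriv hz'
  have hV := hasDerivAt_groundVec hz'
  have hV' : HasDerivAt (fun y => ofEnergy E (groundAmpDeriv E y))
      (ofEnergy E fun e => deriv (fun y => groundAmpDeriv E y e) z) z :=
    hasDerivAt_ofEnergy fun s =>
      ((contDiffAt_groundAmpDeriv hz' s).differentiableAt (by simp)).hasDerivAt
  have hW : HasDerivAt (fun y => ofEnergy E (correctorAmp E y))
      (ofEnergy E fun e => deriv (fun y => correctorAmp E y e) z) z :=
    hasDerivAt_ofEnergy fun s =>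
      ((contDiffAt_correctorAmp hz' s).differentiableAt (by simp)).hasDerivAt
  have hsV'' : (ofEnergy E fun e => deriv (fun y => groundAmpDeriv E y e) z) ∈
      symmetricSubspace E := ofEnergy_mem
  have hsW' : (ofEnergy E fun e => deriv (fun y => correctorAmp E y e) z) ∈
      symmetricSubspace E := ofEnergy_mem
  -- The second derivative of `(H - λ₀) v = 0`.
  have eq2 : ∃ k : ℂ, shiftedHamiltonian E z
      (ofEnergy E fun e => deriv (fun y => groundAmpDeriv E y e) z) - k • groundVec E z =
      -(2 : ℂ) • centeredTarget E z (ofEnergy E (groundAmpDeriv E z)) := by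
    have hX' : HasDerivAt (deriv (groundDepth E)) (deriv (deriv (groundDepth E)) z) z :=
      ((contDiffAt_deriv_infty (contDiffAt_groundDepth hz' (by simp))).differentiableAt
        (by simp)).hasDerivAt
    have h2 := hasDerivAt_shiftedHamiltonian hz' hV'
    have h3 : HasDerivAt (fun y => targetHamiltonian E (groundVec E y))
        (targetHamiltonian E (ofEnergy E (groundAmpDeriv E z))) z :=
      ((targetHamiltonian E).restrictScalars ℝ).hasFDerivAt.comp_hasDerivAt z hV
    have h4 := (h3.fun_add (hX'.fun_smul hV)).fun_neg
    have h5 := h2.unique (h4.congr_of_eventuallyEq (by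
      filter_upwards [isOpen_groundRange.mem_nhds hz'] with y hy
      rw [shiftedHamiltonian_deriv hy, centeredTarget_apply, Complex.coe_smul]))
    refine ⟨-((deriv (deriv (groundDepth E)) z : ℝ) : ℂ), ?_⟩
    rw [eq_sub_of_add_eq h5]
    simp only [centeredTarget_apply, Complex.coe_smul, neg_smul]
    module
  -- The derivative of `(H - λ₀) w = v'`.
  have eq3 : shiftedHamiltonian E z (ofEnergy E fun e => deriv (fun y => correctorAmp E y e) z) =
      (ofEnergy E fun e => deriv (fun y => groundAmpDeriv E y e) z) -
        centeredTarget E z (ofEnergy E (correctorAmp E z)) := by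
    have h2 := hasDerivAt_shiftedHamiltonian hz' hW
    have h3 := h2.unique (hV'.congr_of_eventuallyEq (by
      filter_upwards [isOpen_groundRange.mem_nhds hz'] with y hy
      exact shiftedHamiltonian_corrector hy))
    exact eq_sub_of_add_eq h3
  -- The derivative of `⟨v, w⟩ = 0`.
  have eq4 : inner ℂ (groundVec E z) (ofEnergy E fun e => deriv (fun y => correctorAmp E y e) z) =
      -inner ℂ (ofEnergy E (groundAmpDeriv E z)) (ofEnergy E (correctorAmp E z)) := by
    have h2 := hV.inner ℂ hW
    have h3 := h2.unique ((hasDerivAt_const z (0 : ℂ)).congr_of_eventuallyEq (by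
      filter_upwards [isOpen_groundRange.mem_nhds hz'] with y hy
      exact inner_groundVec_corrector hy))
    exact eq_neg_of_add_eq_zero_left h3
  set v := groundVec E z
  set V' := ofEnergy E (groundAmpDeriv E z)
  set V'' := ofEnergy E fun e => deriv (fun y => groundAmpDeriv E y e) z
  set W := ofEnergy E (correctorAmp E z)
  set W' := ofEnergy E fun e => deriv (fun y => correctorAmp E y e) z
  have b1 : ‖V'‖ ≤ m / g := by
    have h2 := secularGap_mul_norm_sub_le h0 h1 hz (ofEnergy_mem : V' ∈ symmetricSubspace E) 0
    rw [hiV', zero_smul ℂ v, sub_zero, sub_zero, shiftedHamiltonian_deriv hz',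
      norm_neg] at h2
    have h3 := norm_centeredTarget_apply_le h0 hm hz v
    rw [le_div_iff₀' hg]
    rw [hnv, mul_one] at h3
    exact h2.trans h3
  have b2 : ‖W‖ ≤ m / g ^ 2 := by
    have h2 := secularGap_mul_norm_sub_le h0 h1 hz (ofEnergy_mem : W ∈ symmetricSubspace E) 0
    rw [hiW, zero_smul ℂ v, sub_zero, sub_zero, shiftedHamiltonian_corrector hz'] at h2
    have h3 := h2.trans b1
    rw [le_div_iff₀ (by positivity)]
    rw [le_div_iff₀ hg] at h3
    linarith
  have b3 : ‖V'' - inner ℂ v V'' • v‖ ≤ 2 * m ^ 2 / g ^ 2 := by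
    obtain ⟨k, hk⟩ := eq2
    have h2 := secularGap_mul_norm_sub_le h0 h1 hz hsV'' k
    have h4 := norm_centeredTarget_apply_le h0 hm hz V'
    have h5 : m * ‖V'‖ ≤ m * (m / g) := by gcongr
    rw [hk, norm_smul, norm_neg, Complex.norm_ofNat] at h2
    have h6 : g * ‖V'' - inner ℂ v V'' • v‖ ≤ 2 * (m * (m / g)) := by
      change g * ‖V'' - inner ℂ v V'' • v‖ ≤ _ at h2
      linarith
    rw [← le_div_iff₀' hg] at h6
    refine h6.trans_eq ?_
    field_simp
  have b4 : ‖W' - inner ℂ v W' • v‖ ≤ 3 * m ^ 2 / g ^ 3 := by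
    have h2 := secularGap_mul_norm_sub_le h0 h1 hz hsW' (inner ℂ v V'')
    have h4 := norm_centeredTarget_apply_le h0 hm hz W
    have h5 : m * ‖W‖ ≤ m * (m / g ^ 2) := by gcongr
    have h6 : g * ‖W' - inner ℂ v W' • v‖ ≤ 2 * m ^ 2 / g ^ 2 + m * (m / g ^ 2) := by
      refine h2.trans ?_
      rw [eq3, sub_right_comm]
      exact (norm_sub_le _ _).trans (add_le_add b3 (h4.trans h5))
    rw [← le_div_iff₀' hg] at h6
    refine h6.trans_eq ?_
    field_simp
    ring
  refine ⟨b2, W', hW, ?_⟩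
  have h2 : ‖inner ℂ v W' • v‖ ≤ m ^ 2 / g ^ 3 := by
    rw [norm_smul, hnv, mul_one, eq4, norm_neg]
    calc ‖inner ℂ V' W‖ ≤ ‖V'‖ * ‖W‖ := norm_inner_le_norm _ _
      _ ≤ (m / g) * (m / g ^ 2) := by gcongr
      _ = m ^ 2 / g ^ 3 := by field_simp
  calc ‖W'‖ = ‖(W' - inner ℂ v W' • v) + inner ℂ v W' • v‖ := by rw [sub_add_cancel]
    _ ≤ 3 * m ^ 2 / g ^ 3 + m ^ 2 / g ^ 3 := (norm_add_le _ _).trans (add_le_add b4 h2)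
    _ = 4 * m ^ 2 / g ^ 3 := by ring

/-- The ground level of the symmetric subspace is the least eigenvalue on the whole space. -/
theorem isGroundState_groundVec (h0 : 0 < numSolutions E) {z : ℝ} (hz : 0 ≤ z) {k : ℂ}
    (hk : ‖k‖ = 1) : IsGroundState (hamiltonian E z) (k • groundVec E z) := by
  have hz' := mem_groundRange h0 hz
  refine ⟨by rw [norm_smul, hk, norm_groundVec hz', mul_one], -groundDepth E z, ?_, ?_⟩
  · rw [map_smul, hamiltonian_groundVec hz', smul_comm]
  · intro ν w hw h
    exact neg_groundDepth_le h0 hz hw h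

end groundState

/-! ### The schedule -/

/-- The boundary-value problem `ż = c γ(z)²`, `z(0) = 0`, `z(1) = zf` is solved by the inverse of the
antiderivative of `γ⁻²`, with `c` the integral of `γ⁻²` over `[0, zf]`. -/
theorem exists_schedule {γ : ℝ → ℝ} (hγ : Continuous γ) (hpos : ∀ z, 0 < γ z) {zf : ℝ}
    (hzf : 0 < zf) : ∃ Z : ℝ → ℝ, Z 0 = 0 ∧ Z 1 = zf ∧ ∀ β ∈ Icc (0 : ℝ) 1, Z β ∈ Icc 0 zf ∧
      HasDerivAt Z ((∫ x in (0 : ℝ)..zf, 1 / γ x ^ 2) * γ (Z β) ^ 2) β := by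
  have hcont : Continuous fun x => 1 / γ x ^ 2 :=
    continuous_const.div (hγ.pow 2) fun x => (pow_pos (hpos x) 2).ne'
  set F : ℝ → ℝ := fun z => ∫ x in (0 : ℝ)..z, 1 / γ x ^ 2 with hF
  have hFd : ∀ z, HasDerivAt F (1 / γ z ^ 2) z := fun z =>
    intervalIntegral.integral_hasDerivAt_right (hcont.intervalIntegrable _ _)
      (hcont.stronglyMeasurableAtFilter _ _) hcont.continuousAt
  have hFpos : ∀ z, 0 < 1 / γ z ^ 2 := fun z => one_div_pos.2 (pow_pos (hpos z) 2)
  have hFmono : StrictMono F := strictMono_of_deriv_pos fun z => by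
    rw [(hFd z).deriv]; exact hFpos z
  have hFC : ContDiff ℝ 1 F := by
    rw [contDiff_one_iff_deriv]
    refine ⟨fun z => (hFd z).differentiableAt, ?_⟩
    rwa [funext fun z => (hFd z).deriv]
  have hF0 : F 0 = 0 := by simp [hF]
  have hc : 0 < F zf := by rw [← hF0]; exact hFmono hzf
  set G := Function.invFunOn F univ with hG
  have hGF : ∀ a, G (F a) = a := fun a => hFmono.injective.injOn.leftInvOn_invFunOn (mem_univ a)
  refine ⟨fun β => G (F zf * β), ?_, ?_, ?_⟩
  · have := hGF 0
    rw [hF0] at this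
    simpa using this
  · simp only [mul_one]
    exact hGF zf
  · intro β hβ
    have h1 : F zf * β ∈ Icc (F 0) (F zf) := by
      rw [hF0]
      exact ⟨mul_nonneg hc.le hβ.1, mul_le_of_le_one_right hc.le hβ.2⟩
    obtain ⟨a, ha, hFa⟩ := intermediate_value_Icc hzf.le hFC.continuous.continuousOn h1
    have h2 : G (F zf * β) = a := by rw [← hFa, hGF]
    simp only [h2]
    refine ⟨ha, ?_⟩
    have h3 := hasDerivAt_invFunOn isOpen_univ hFmono.injective.injOn (mem_univ a) hFC.contDiffAt
      (hFd a) (hFpos a).ne'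
    rw [hFa] at h3
    have h4 := HasDerivAt.comp β h3 ((hasDerivAt_id β).const_mul (F zf))
    refine h4.congr_deriv ?_
    rw [one_div, inv_inv, mul_one, mul_comm]

/-- `Z` solves the boundary-value problem of the schedule, with the gap expressed by the solutions of
the secular equation. -/
structure IsSecularSchedule (E : (Fin n → Bool) → ℕ) (zf c : ℝ) (Z : ℝ → ℝ) : Prop where
  initial : Z 0 = 0
  final : Z 1 = zf
  mem : ∀ β ∈ Icc (0 : ℝ) 1, Z β ∈ Icc 0 zf
  ode : ∀ β ∈ Icc (0 : ℝ) 1, HasDerivAt Z (c * secularGap E (Z β) ^ 2) β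

section schedule

variable {E : (Fin n → Bool) → ℕ}

theorem continuous_secularGap_max (h0 : 0 < numSolutions E) (h1 : ∃ s, E s ≠ 0) :
    Continuous fun z => secularGap E (max 0 z) :=
  continuous_iff_continuousAt.2 fun z =>
    ContinuousAt.comp (f := fun z : ℝ => max 0 z)
      (contDiffAt_secularGap h0 h1 (le_max_left 0 z) one_ne_zero).continuousAt (by fun_prop)

theorem exists_isSecularSchedule (h0 : 0 < numSolutions E) (h1 : ∃ s, E s ≠ 0) {zf : ℝ}
    (hzf : 0 < zf) : ∃ Z, IsSecularSchedule E zf (∫ x in (0 : ℝ)..zf, 1 / secularGap E x ^ 2) Z := by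
  obtain ⟨Z, hZ0, hZ1, hZ⟩ := exists_schedule (continuous_secularGap_max h0 h1)
    (fun z => secularGap_pos h0 h1 (le_max_left 0 z)) hzf
  refine ⟨Z, hZ0, hZ1, fun β hβ => (hZ β hβ).1, fun β hβ => ?_⟩
  have h2 := (hZ β hβ).2
  rw [max_eq_right (hZ β hβ).1.1] at h2
  have h3 : (∫ x in (0 : ℝ)..zf, 1 / secularGap E (max 0 x) ^ 2) =
      ∫ x in (0 : ℝ)..zf, 1 / secularGap E x ^ 2 := by
    refine intervalIntegral.integral_congr fun x hx => ?_
    rw [uIcc_of_le hzf.le] at hx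
    simp only [max_eq_right hx.1]
  rwa [h3] at h2

variable {zf c : ℝ} {Z : ℝ → ℝ}

/-- The time integral of `c g(z(β))` along the schedule is the integral of `1 / g` over
`[0, zf]`. -/
theorem IsSecularSchedule.exists_antideriv (hZ : IsSecularSchedule E zf c Z)
    (h0 : 0 < numSolutions E) (h1 : ∃ s, E s ≠ 0) (hzf : 0 < zf) :
    ∃ Λ : ℝ → ℝ, Λ 0 = 0 ∧ Λ 1 = (∫ x in (0 : ℝ)..zf, 1 / secularGap E x) ∧
      ∀ β ∈ Icc (0 : ℝ) 1, HasDerivAt Λ (c * secularGap E (Z β)) β := by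
  have hcont : Continuous fun x => 1 / secularGap E (max 0 x) :=
    continuous_const.div (continuous_secularGap_max h0 h1)
      fun x => (secularGap_pos h0 h1 (le_max_left 0 x)).ne'
  refine ⟨fun β => ∫ x in (0 : ℝ)..Z β, 1 / secularGap E (max 0 x), ?_, ?_, ?_⟩
  · simp [hZ.initial]
  · simp only [hZ.final]
    refine intervalIntegral.integral_congr fun x hx => ?_
    rw [uIcc_of_le hzf.le] at hx
    simp only [max_eq_right hx.1]
  · intro β hβ
    have h2 : HasDerivAt (fun z => ∫ x in (0 : ℝ)..z, 1 / secularGap E (max 0 x))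
        (1 / secularGap E (max 0 (Z β))) (Z β) :=
      intervalIntegral.integral_hasDerivAt_right (hcont.intervalIntegrable _ _)
        (hcont.stronglyMeasurableAtFilter _ _) hcont.continuousAt
    rw [max_eq_right (hZ.mem β hβ).1] at h2
    have := (secularGap_pos h0 h1 (hZ.mem β hβ).1).ne'
    refine (HasDerivAt.comp β h2 (hZ.ode β hβ)).congr_deriv ?_
    field_simp

theorem IsSecularSchedule.continuousOn (hZ : IsSecularSchedule E zf c Z) :
    ContinuousOn Z (Icc 0 1) :=
  fun β hβ => (hZ.ode β hβ).continuousAt.continuousWithinAt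

theorem IsSecularSchedule.continuousOn_secularGap (hZ : IsSecularSchedule E zf c Z)
    (h0 : 0 < numSolutions E) (h1 : ∃ s, E s ≠ 0) :
    ContinuousOn (fun β => secularGap E (Z β)) (Icc 0 1) := fun β hβ =>
  ((contDiffAt_secularGap h0 h1 (hZ.mem β hβ).1 one_ne_zero).continuousAt.comp
    (hZ.ode β hβ).continuousAt).continuousWithinAt

/-- A solution of the schedule equation gains one order of smoothness over the right-hand side. -/
theorem IsSecularSchedule.contDiffOn (hZ : IsSecularSchedule E zf c Z)
    (h0 : 0 < numSolutions E) (h1 : ∃ s, E s ≠ 0) : ContDiffOn ℝ 2 Z (Icc 0 1) := by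
  have hu : UniqueDiffOn ℝ (Icc (0 : ℝ) 1) := uniqueDiffOn_Icc zero_lt_one
  have hder : ∀ β ∈ Icc (0 : ℝ) 1, derivWithin Z (Icc 0 1) β = c * secularGap E (Z β) ^ 2 :=
    fun β hβ => (hZ.ode β hβ).hasDerivWithinAt.derivWithin (hu β hβ)
  have hdiff : DifferentiableOn ℝ Z (Icc 0 1) := fun β hβ =>
    (hZ.ode β hβ).differentiableAt.differentiableWithinAt
  have hstep : ∀ k : WithTop ℕ∞, ContDiffOn ℝ k Z (Icc 0 1) →
      ContDiffOn ℝ k (derivWithin Z (Icc 0 1)) (Icc 0 1) := by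
    intro k hk
    have h2 : ContDiffOn ℝ k (fun β => c * secularGap E (Z β) ^ 2) (Icc 0 1) := by
      intro β hβ
      have h3 : ContDiffAt ℝ k (secularGap E) (Z β) := by
        rcases eq_or_ne k 0 with rfl | h
        · exact (contDiffAt_secularGap h0 h1 (hZ.mem β hβ).1 one_ne_zero).of_le zero_le_one
        · exact contDiffAt_secularGap h0 h1 (hZ.mem β hβ).1 h
      exact contDiffWithinAt_const.mul ((h3.comp_contDiffWithinAt β (hk β hβ)).pow 2)
    exact h2.congr hder
  have hC1 : ContDiffOn ℝ 1 Z (Icc 0 1) := by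
    rw [← zero_add 1, contDiffOn_succ_iff_derivWithin hu]
    exact ⟨hdiff, by simp, hstep 0 (contDiffOn_zero.2 hZ.continuousOn)⟩
  rw [← one_add_one_eq_two, contDiffOn_succ_iff_derivWithin hu]
  exact ⟨hdiff, by simp, hstep 1 hC1⟩

theorem IsSecularSchedule.isLocalSchedule (hZ : IsSecularSchedule E zf c Z)
    (h0 : 0 < numSolutions E) (h1 : ∃ s, E s ≠ 0) : IsLocalSchedule E zf c Z where
  contDiffOn := hZ.contDiffOn h0 h1
  initial := hZ.initial
  final := hZ.final
  ode β hβ := by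
    rw [gap_eq_secularGap h0 h1 (hZ.mem β hβ).1]
    exact (hZ.ode β hβ).hasDerivWithinAt

theorem IsSecularSchedule.exists_hasDerivAt_speed (hZ : IsSecularSchedule E zf c Z)
    (h0 : 0 < numSolutions E) (h1 : ∃ s, E s ≠ 0) {m : ℕ} (hm : ∀ s, E s ≤ m) {β : ℝ}
    (hβ : β ∈ Icc (0 : ℝ) 1) : ∃ k' : ℝ, |k'| ≤ 2 * c ^ 2 * m * secularGap E (Z β) ^ 3 ∧
      HasDerivAt (fun β => c * secularGap E (Z β) ^ 2) k' β := by
  obtain ⟨l, hl, hd⟩ := exists_hasDerivAt_secularGap h0 h1 hm (hZ.mem β hβ).1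
  have hg := secularGap_pos h0 h1 (hZ.mem β hβ).1
  have h2 : HasDerivAt (fun β => c * secularGap E (Z β) ^ 2) _ β :=
    ((HasDerivAt.comp β hd (hZ.ode β hβ)).pow 2).const_mul c
  refine ⟨_, ?_, h2⟩
  simp only [Function.comp_apply, Nat.cast_ofNat, Nat.add_one_sub_one, pow_one]
  have h3 : c * (2 * secularGap E (Z β) * (l * (c * secularGap E (Z β) ^ 2))) =
      2 * c ^ 2 * secularGap E (Z β) ^ 3 * l := by ring
  rw [h3, abs_mul, abs_of_nonneg (by positivity)]
  calc 2 * c ^ 2 * secularGap E (Z β) ^ 3 * |l| ≤ 2 * c ^ 2 * secularGap E (Z β) ^ 3 * m := by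
        gcongr
    _ = _ := by ring

/-! ### The adiabatic cost of the schedule -/

theorem norm_targetHamiltonian_le {m : ℕ} (hm : ∀ s, E s ≤ m) : ‖targetHamiltonian E‖ ≤ m := by
  refine ContinuousLinearMap.opNorm_le_bound _ (by positivity) fun v => ?_
  simpa using norm_targetHamiltonian_add_apply_le hm (left_mem_Icc.2 (Nat.cast_nonneg m)) v

theorem hasDerivWithinAt_hamiltonian {Y : ℝ → ℝ} {k β : ℝ} {s : Set ℝ}
    (h : HasDerivWithinAt Y k s β) :
    HasDerivWithinAt (fun b => hamiltonian E (Y b)) (k • targetHamiltonian E) s β := by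
  have h2 : (fun b => hamiltonian E (Y b)) =
      fun b => mixingHamiltonian n + Y b • targetHamiltonian E := by
    ext b v : 2
    simp [hamiltonian]
  rw [h2]
  exact (h.smul_const (targetHamiltonian E)).const_add (mixingHamiltonian n)

theorem IsSecularSchedule.derivWithin_hamiltonian (hZ : IsSecularSchedule E zf c Z) {β : ℝ}
    (hβ : β ∈ Icc (0 : ℝ) 1) : derivWithin (fun b => hamiltonian E (Z b)) (Icc 0 1) β =
      (c * secularGap E (Z β) ^ 2) • targetHamiltonian E :=
  (hasDerivWithinAt_hamiltonian (hZ.ode β hβ).hasDerivWithinAt).derivWithin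
    (uniqueDiffOn_Icc zero_lt_one β hβ)

/-- Along the schedule the cost is at most `2 c m + 9 m² c ∫ dz / g`: the speed `c g²` makes the
integrand of the cost at most `9 m² c² g`, and `c g dβ = dz / g`. -/
theorem IsSecularSchedule.adiabaticCost_le (hZ : IsSecularSchedule E zf c Z)
    (h0 : 0 < numSolutions E) (h1 : ∃ s, E s ≠ 0) {m : ℕ} (hm : ∀ s, E s ≤ m) (hzf : 0 < zf)
    (hc : 0 ≤ c) : adiabaticCost E Z ≤ ENNReal.ofReal
      (2 * c * m + 9 * m ^ 2 * c * ∫ x in (0 : ℝ)..zf, 1 / secularGap E x) := by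
  obtain ⟨Λ, hΛ0, hΛ1, hΛ⟩ := hZ.exists_antideriv h0 h1 hzf
  have hu : UniqueDiffOn ℝ (Icc (0 : ℝ) 1) := uniqueDiffOn_Icc zero_lt_one
  have hHf := norm_targetHamiltonian_le hm
  have hgpos : ∀ β ∈ Icc (0 : ℝ) 1, 0 < secularGap E (Z β) := fun β hβ =>
    secularGap_pos h0 h1 (hZ.mem β hβ).1
  have hgap : ∀ β ∈ Icc (0 : ℝ) 1, gap E (Z β) = secularGap E (Z β) := fun β hβ =>
    gap_eq_secularGap h0 h1 (hZ.mem β hβ).1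
  have hd1 : ∀ β ∈ Icc (0 : ℝ) 1, ‖derivWithin (fun b => hamiltonian E (Z b)) (Icc 0 1) β‖ₑ ≤
      ENNReal.ofReal (c * secularGap E (Z β) ^ 2 * m) := by
    intro β hβ
    rw [hZ.derivWithin_hamiltonian hβ, ← ofReal_norm, norm_smul, Real.norm_eq_abs,
      abs_of_nonneg (by positivity)]
    gcongr
  have hd2 : ∀ β ∈ Icc (0 : ℝ) 1,
      ‖iteratedDerivWithin 2 (fun b => hamiltonian E (Z b)) (Icc 0 1) β‖ₑ ≤
      ENNReal.ofReal (2 * c ^ 2 * m * secularGap E (Z β) ^ 3 * m) := by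
    intro β hβ
    obtain ⟨k', hk', hd⟩ := hZ.exists_hasDerivAt_speed h0 h1 hm hβ
    have h2 : iteratedDerivWithin 2 (fun b => hamiltonian E (Z b)) (Icc 0 1) β =
        k' • targetHamiltonian E := by
      rw [iteratedDerivWithin_succ]
      refine HasDerivWithinAt.derivWithin ?_ (hu β hβ)
      refine (hd.hasDerivWithinAt.smul_const (targetHamiltonian E)).congr_of_mem
        (fun b hb => ?_) hβ
      rw [iteratedDerivWithin_one, hZ.derivWithin_hamiltonian hb]
    have := hgpos β hβ
    rw [h2, ← ofReal_norm, norm_smul, Real.norm_eq_abs]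
    gcongr
  have hsup : (⨆ β ∈ Icc (0 : ℝ) 1, ‖derivWithin (fun b => hamiltonian E (Z b)) (Icc 0 1) β‖ₑ
        / ENNReal.ofReal (gap E (Z β)) ^ 2) ≤ ENNReal.ofReal (c * m) := by
    refine iSup₂_le fun β hβ => ?_
    have hg := hgpos β hβ
    rw [hgap β hβ, ← ENNReal.ofReal_pow hg.le]
    refine (ENNReal.div_le_div_right (hd1 β hβ) _).trans_eq ?_
    rw [← ENNReal.ofReal_div_of_pos (by positivity)]
    congr 1
    field_simp
  have hint : (∫⁻ β in Icc (0 : ℝ) 1,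
      (‖iteratedDerivWithin 2 (fun b => hamiltonian E (Z b)) (Icc 0 1) β‖ₑ
          / ENNReal.ofReal (gap E (Z β)) ^ 2
        + 7 * ‖derivWithin (fun b => hamiltonian E (Z b)) (Icc 0 1) β‖ₑ ^ 2
          / ENNReal.ofReal (gap E (Z β)) ^ 3)) ≤
      ENNReal.ofReal (9 * m ^ 2 * c * ∫ x in (0 : ℝ)..zf, 1 / secularGap E x) := by
    have hcg : ContinuousOn (fun β => 9 * m ^ 2 * c * (c * secularGap E (Z β))) (Icc 0 1) :=
      continuousOn_const.mul (continuousOn_const.mul (hZ.continuousOn_secularGap h0 h1))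
    have h2 : (∫ β in Icc (0 : ℝ) 1, 9 * m ^ 2 * c * (c * secularGap E (Z β))) =
        9 * m ^ 2 * c * ∫ x in (0 : ℝ)..zf, 1 / secularGap E x := by
      rw [integral_Icc_eq_integral_Ioc, ← intervalIntegral.integral_of_le zero_le_one,
        intervalIntegral.integral_const_mul]
      rw [intervalIntegral.integral_eq_sub_of_hasDerivAt
        (fun β hβ => hΛ β (by rwa [uIcc_of_le zero_le_one] at hβ)), hΛ0, hΛ1, sub_zero]
      refine ContinuousOn.intervalIntegrable ?_
      rw [uIcc_of_le zero_le_one]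
      exact continuousOn_const.mul (hZ.continuousOn_secularGap h0 h1)
    rw [← h2, ofReal_integral_eq_lintegral_ofReal (hcg.integrableOn_compact isCompact_Icc)]
    · refine setLIntegral_mono' measurableSet_Icc fun β hβ => ?_
      have hg := hgpos β hβ
      rw [hgap β hβ, ← ENNReal.ofReal_pow hg.le, ← ENNReal.ofReal_pow hg.le]
      have e1 := ENNReal.div_le_div_right (hd2 β hβ) (ENNReal.ofReal (secularGap E (Z β) ^ 2))
      have e2 : 7 * ‖derivWithin (fun b => hamiltonian E (Z b)) (Icc 0 1) β‖ₑ ^ 2 ≤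
          ENNReal.ofReal (7 * (c * secularGap E (Z β) ^ 2 * m) ^ 2) := by
        rw [ENNReal.ofReal_mul (by norm_num), ENNReal.ofReal_pow (by positivity),
          ENNReal.ofReal_ofNat]
        gcongr
        exact hd1 β hβ
      have e3 := ENNReal.div_le_div_right e2 (ENNReal.ofReal (secularGap E (Z β) ^ 3))
      refine (add_le_add e1 e3).trans_eq ?_
      rw [← ENNReal.ofReal_div_of_pos (by positivity), ← ENNReal.ofReal_div_of_pos (by positivity),
        ← ENNReal.ofReal_add (by positivity) (by positivity)]
      congr 1
      field_simp
      ring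
    · refine (ae_restrict_iff' measurableSet_Icc).2 (Filter.Eventually.of_forall fun β hβ => ?_)
      have hg := hgpos β hβ
      simp only [Pi.zero_apply]
      positivity
  have hLnn : 0 ≤ ∫ x in (0 : ℝ)..zf, 1 / secularGap E x :=
    intervalIntegral.integral_nonneg hzf.le fun x hx =>
      (one_div_pos.2 (secularGap_pos h0 h1 hx.1)).le
  rw [adiabaticCost, ENNReal.ofReal_add (by positivity) (by positivity)]
  refine add_le_add ?_ hint
  rw [mul_assoc, ENNReal.ofReal_mul zero_le_two, ENNReal.ofReal_ofNat]
  gcongr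

/-! ### Integrals of inverse powers of the gap -/

/-- If `a ≤ g`, then `2 g² ≥ a² + (z - Z₁)²`, and the antiderivative of the inverse of the right-hand
side is an arctangent. -/
theorem integral_inv_secularGap_sq_le (h0 : 0 < numSolutions E) (h1 : ∃ s, E s ≠ 0) {a zf : ℝ}
    (ha : 0 < a) (hzf : 0 ≤ zf) (hga : ∀ z, 0 ≤ z → a ≤ secularGap E z) :
    ∫ x in (0 : ℝ)..zf, 1 / secularGap E x ^ 2 ≤ 2 * Real.pi / a := by
  set A := invEnergyMean E
  have hd : ∀ x, HasDerivAt (fun x => 2 / a * Real.arctan ((x - A) / a))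
      (2 / a * (1 / (1 + ((x - A) / a) ^ 2) * (1 / a))) x := fun x =>
    ((((hasDerivAt_id' x).sub_const A).div_const a).arctan).const_mul _
  have hcont : ContinuousOn (fun x => 1 / secularGap E x ^ 2) (Icc 0 zf) := fun x hx =>
    (continuousAt_const.div ((contDiffAt_secularGap h0 h1 hx.1 one_ne_zero).continuousAt.pow 2)
      (pow_pos (secularGap_pos h0 h1 hx.1) 2).ne').continuousWithinAt
  have h2 := intervalIntegral.integral_le_sub_of_hasDeriv_right_of_le hzf
    (fun x _ => (hd x).continuousAt.continuousWithinAt) (fun x _ => (hd x).hasDerivWithinAt)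
    (hcont.integrableOn_compact isCompact_Icc) (fun x hx => by
      have hg := secularGap_pos h0 h1 hx.1.le
      have h3 := abs_sub_le_secularGap h0 h1 hx.1.le
      have h4 := hga x hx.1.le
      have h5 : (x - A) ^ 2 ≤ secularGap E x ^ 2 := by
        rw [← sq_abs]
        gcongr
      have h6 : a ^ 2 ≤ secularGap E x ^ 2 := by gcongr
      have h7 : 2 / a * (1 / (1 + ((x - A) / a) ^ 2) * (1 / a)) = 2 / (a ^ 2 + (x - A) ^ 2) := by
        field_simp
      rw [h7, div_le_div_iff₀ (by positivity) (by positivity)]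
      linarith)
  refine h2.trans ?_
  have h3 := Real.arctan_lt_pi_div_two ((zf - A) / a)
  have h4 := Real.neg_pi_div_two_lt_arctan ((0 - A) / a)
  rw [← mul_sub]
  calc 2 / a * (Real.arctan ((zf - A) / a) - Real.arctan ((0 - A) / a)) ≤ 2 / a * Real.pi := by
        gcongr
        linarith
    _ = 2 * Real.pi / a := by ring

/-- If `a ≤ g`, then `g` is at least half the hyperbola `√(a² + (z - Z₁)²)`, whose inverse has an
inverse hyperbolic sine as antiderivative. -/
theorem integral_inv_secularGap_le (h0 : 0 < numSolutions E) (h1 : ∃ s, E s ≠ 0) {a zf q : ℝ}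
    (ha : 0 < a) (hzf : 0 ≤ zf) (hq : zf ≤ q) (hga : ∀ z, 0 ≤ z → a ≤ secularGap E z) :
    ∫ x in (0 : ℝ)..zf, 1 / secularGap E x ≤ 4 * Real.log (1 + 2 * ((q + 1) / a)) := by
  set A := invEnergyMean E with hA
  have hA0 : 0 ≤ A := invEnergyMean_nonneg
  have hA1 : A ≤ 1 := invEnergyMean_le_one
  have hd : ∀ x, HasDerivAt (fun x => 2 * Real.arsinh ((x - A) / a))
      (2 * ((Real.sqrt (1 + ((x - A) / a) ^ 2))⁻¹ • (1 / a))) x := fun x =>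
    ((((hasDerivAt_id' x).sub_const A).div_const a).arsinh).const_mul _
  have hcont : ContinuousOn (fun x => 1 / secularGap E x) (Icc 0 zf) := fun x hx =>
    (continuousAt_const.div (contDiffAt_secularGap h0 h1 hx.1 one_ne_zero).continuousAt
      (secularGap_pos h0 h1 hx.1).ne').continuousWithinAt
  have h2 := intervalIntegral.integral_le_sub_of_hasDeriv_right_of_le hzf
    (fun x _ => (hd x).continuousAt.continuousWithinAt) (fun x _ => (hd x).hasDerivWithinAt)
    (hcont.integrableOn_compact isCompact_Icc) (fun x hx => by
      have hg := secularGap_pos h0 h1 hx.1.le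
      have h3 := abs_sub_le_secularGap h0 h1 hx.1.le
      have h4 := hga x hx.1.le
      have h5 : (x - A) ^ 2 ≤ secularGap E x ^ 2 := by
        rw [← sq_abs]
        gcongr
      have h6 : a ^ 2 ≤ secularGap E x ^ 2 := by gcongr
      have h7 : a * Real.sqrt (1 + ((x - A) / a) ^ 2) ≤ 2 * secularGap E x := by
        refine abs_le_of_sq_le_sq' ?_ (by positivity) |>.2
        rw [mul_pow, Real.sq_sqrt (by positivity)]
        have h8 : a ^ 2 * (1 + ((x - A) / a) ^ 2) = a ^ 2 + (x - A) ^ 2 := by field_simp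
        rw [h8]
        nlinarith
      have h9 : 2 * ((Real.sqrt (1 + ((x - A) / a) ^ 2))⁻¹ • (1 / a)) =
          2 / (a * Real.sqrt (1 + ((x - A) / a) ^ 2)) := by
        rw [smul_eq_mul]
        have : 0 < Real.sqrt (1 + ((x - A) / a) ^ 2) := Real.sqrt_pos.2 (by positivity)
        field_simp
      rw [h9, div_le_div_iff₀ hg (by positivity)]
      linarith)
  refine h2.trans ?_
  set b := (q + 1) / a with hb
  have hq0 : 0 ≤ q := hzf.trans hq
  have hb0 : 0 ≤ b := by positivity
  have h3 : Real.arsinh ((zf - A) / a) ≤ Real.arsinh b :=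
    Real.arsinh_le_arsinh.2 (by rw [hb]; gcongr; linarith)
  have h4 : -Real.arsinh b ≤ Real.arsinh ((0 - A) / a) := by
    rw [← Real.arsinh_neg, Real.arsinh_le_arsinh, hb, ← neg_div]
    gcongr
    linarith
  have h5 : Real.arsinh b ≤ Real.log (1 + 2 * b) := by
    rw [Real.arsinh]
    refine Real.log_le_log (by positivity) ?_
    have : Real.sqrt (1 + b ^ 2) ≤ 1 + b := Real.sqrt_le_iff.2 ⟨by positivity, by nlinarith⟩
    linarith
  linarith

end schedule

/-! ### The adiabatic theorem -/

/-- A perturbation `f` of a norm-preserving evolution changes the norm at most at the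
rate `‖f‖`. -/
theorem norm_le_add_of_hasDerivWithinAt {F : Type*} [NormedAddCommGroup F] [InnerProductSpace ℂ F]
    {d g f : ℝ → F} {b b' : ℝ → ℝ}
    (hd : ∀ β ∈ Icc (0 : ℝ) 1, HasDerivWithinAt d (g β + f β) (Icc 0 1) β)
    (hg : ∀ β ∈ Icc (0 : ℝ) 1, (inner ℂ (d β) (g β)).re = 0)
    (hb : ∀ β ∈ Icc (0 : ℝ) 1, HasDerivAt b (b' β) β)
    (hf : ∀ β ∈ Icc (0 : ℝ) 1, ‖f β‖ ≤ b' β) : ‖d 1‖ ≤ ‖d 0‖ + (b 1 - b 0) := by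
  refine le_of_forall_pos_le_add fun η hη => ?_
  -- The norm is regularized to make it differentiable where `d` vanishes.
  have hN : ∀ β ∈ Icc (0 : ℝ) 1, HasDerivWithinAt (fun β => Real.sqrt (‖d β‖ ^ 2 + η ^ 2))
      ((inner ℂ (d β) (f β)).re / Real.sqrt (‖d β‖ ^ 2 + η ^ 2)) (Icc 0 1) β := by
    intro β hβ
    have h1 := Complex.reCLM.hasFDerivAt.comp_hasDerivWithinAt β
      ((hd β hβ).inner ℂ (hd β hβ))
    have h2 : ∀ β, (inner ℂ (d β) (d β)).re = ‖d β‖ ^ 2 := fun β => by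
      rw [inner_self_eq_norm_sq_to_K]
      simp [← Complex.ofReal_pow]
    have h3 : HasDerivWithinAt (fun β => ‖d β‖ ^ 2 + η ^ 2) (2 * (inner ℂ (d β) (f β)).re)
        (Icc 0 1) β := by
      have h4 := h1.add_const (η ^ 2)
      refine (h4.congr_of_mem (fun b _ => ?_) hβ).congr_deriv ?_
      · exact (congrArg (· + η ^ 2) (h2 b)).symm
      · rw [Complex.reCLM_apply, Complex.add_re, ← inner_conj_symm (g β + f β), Complex.conj_re,
          inner_add_right, Complex.add_re, hg β hβ]
        ring
    have h5 : ‖d β‖ ^ 2 + η ^ 2 ≠ 0 := by positivity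
    refine (h3.sqrt h5).congr_deriv ?_
    rw [mul_div_mul_left _ _ two_ne_zero]
  have hici : ∀ {h : ℝ → ℝ} {h' β : ℝ}, β ∈ Ico (0 : ℝ) 1 → HasDerivWithinAt h h' (Icc 0 1) β →
      HasDerivWithinAt h h' (Ici β) β := fun hβ h =>
    (h.mono (Icc_subset_Icc_left hβ.1)).mono_of_mem_nhdsWithin (Icc_mem_nhdsGE hβ.2)
  have key := image_le_of_deriv_right_le_deriv_boundary
    (f := fun β => Real.sqrt (‖d β‖ ^ 2 + η ^ 2)) (B := fun β => ‖d 0‖ + η + (b β - b 0))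
    (fun β hβ => (hN β hβ).continuousWithinAt)
    (fun β hβ => hici hβ (hN β ⟨hβ.1, hβ.2.le⟩))
    (by
      simp only [sub_self, add_zero]
      exact Real.sqrt_le_iff.2 ⟨by positivity, by nlinarith [norm_nonneg (d 0)]⟩)
    (fun β hβ => ((hb β hβ).sub_const _).const_add _ |>.continuousAt.continuousWithinAt)
    (fun β hβ => ((hb β ⟨hβ.1, hβ.2.le⟩).sub_const _).const_add _ |>.hasDerivWithinAt)
    (fun β hβ => by
      have h1 : 0 < Real.sqrt (‖d β‖ ^ 2 + η ^ 2) := Real.sqrt_pos.2 (by positivity)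
      have h2 : ‖d β‖ ≤ Real.sqrt (‖d β‖ ^ 2 + η ^ 2) :=
        Real.le_sqrt_of_sq_le (by linarith [sq_nonneg η])
      have h3 := hf β ⟨hβ.1, hβ.2.le⟩
      rw [div_le_iff₀ h1]
      calc (inner ℂ (d β) (f β)).re ≤ ‖inner ℂ (d β) (f β)‖ := Complex.re_le_norm _
        _ ≤ ‖d β‖ * ‖f β‖ := norm_inner_le_norm _ _
        _ ≤ Real.sqrt (‖d β‖ ^ 2 + η ^ 2) * b' β := by gcongr
        _ = _ := mul_comm _ _)
    (right_mem_Icc.2 zero_le_one)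
  have h1 : ‖d 1‖ ≤ Real.sqrt (‖d 1‖ ^ 2 + η ^ 2) :=
    Real.le_sqrt_of_sq_le (by linarith [sq_nonneg η])
  linarith

theorem exists_antideriv_of_continuousOn {f : ℝ → ℝ} (hf : ContinuousOn f (Icc 0 1)) :
    ∃ F : ℝ → ℝ, F 0 = 0 ∧ ∀ β ∈ Icc (0 : ℝ) 1, HasDerivAt F (f (projIcc 0 1 zero_le_one β)) β := by
  have hcont : Continuous fun β : ℝ => f (projIcc 0 1 zero_le_one β) :=
    (continuousOn_iff_continuous_domRestrict.1 hf).comp continuous_projIcc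
  refine ⟨fun β => ∫ x in (0 : ℝ)..β, f (projIcc 0 1 zero_le_one x), by simp, fun β _ => ?_⟩
  exact intervalIntegral.integral_hasDerivAt_right (hcont.intervalIntegrable _ _)
    (hcont.stronglyMeasurableAtFilter _ _) hcont.continuousAt

section adiabatic

variable {E : (Fin n → Bool) → ℕ} {zf c : ℝ} {Z : ℝ → ℝ}

theorem re_inner_smul_hamiltonian (z T : ℝ) (v : Qubits n) :
    (inner ℂ v (-(Complex.I * T) • hamiltonian E z v)).re = 0 := by
  have h1 : (inner ℂ v (hamiltonian E z v)).im = 0 := by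
    have h2 := isSymmetric_hamiltonian E z v v
    simp only [ContinuousLinearMap.coe_coe] at h2
    rw [← Complex.conj_eq_iff_im, inner_conj_symm, h2]
  rw [inner_smul_right]
  simp [h1]

/-- The quantitative adiabatic theorem for the schedule. The evolved state `ψ` differs from the
ground state `p v` with its dynamical phase `p`, corrected by the first-order term `(i/T) p ż w`, by a
vector which solves the Schrödinger equation up to an error of norm at most `6 m² c² g / T`. -/
theorem IsSecularSchedule.exists_norm_sub_le (hZ : IsSecularSchedule E zf c Z)
    (h0 : 0 < numSolutions E) (h1 : ∃ s, E s ≠ 0) {m : ℕ} (hm : ∀ s, E s ≤ m) (hzf : 0 < zf)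
    (hc : 0 ≤ c) {T : ℝ} (hT : 0 < T) {ψ : ℝ → Qubits n} (hψ : IsEvolution E Z T ψ) :
    ∃ k : ℂ, ‖k‖ = 1 ∧ ‖ψ T - k • groundVec E zf‖ ≤
      (2 * c * m + 6 * m ^ 2 * c * ∫ x in (0 : ℝ)..zf, 1 / secularGap E x) / T := by
  obtain ⟨Λ, hΛ0, hΛ1, hΛ⟩ := hZ.exists_antideriv h0 h1 hzf
  have hgpos : ∀ β ∈ Icc (0 : ℝ) 1, 0 < secularGap E (Z β) := fun β hβ =>
    secularGap_pos h0 h1 (hZ.mem β hβ).1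
  obtain ⟨Θ, hΘ0, hΘ'⟩ := exists_antideriv_of_continuousOn
    (f := fun β => groundDepth E (Z β)) fun β hβ =>
      ((contDiffAt_groundDepth (mem_groundRange h0 (hZ.mem β hβ).1)
        one_ne_zero).continuousAt.comp (hZ.ode β hβ).continuousAt).continuousWithinAt
  have hΘ : ∀ β ∈ Icc (0 : ℝ) 1, HasDerivAt Θ (groundDepth E (Z β)) β := fun β hβ => by
    have := hΘ' β hβ
    rwa [projIcc_of_mem zero_le_one hβ] at this
  -- The dynamical phase.
  set p : ℝ → ℂ := fun β => Complex.exp (((T * Θ β : ℝ) : ℂ) * Complex.I) with hp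
  have hpnorm : ∀ β, ‖p β‖ = 1 := fun β => Complex.norm_exp_ofReal_mul_I _
  have hp0 : p 0 = 1 := by simp [hp, hΘ0]
  have hpd : ∀ β ∈ Icc (0 : ℝ) 1,
      HasDerivAt p (p β * (((T * groundDepth E (Z β) : ℝ) : ℂ) * Complex.I)) β := fun β hβ =>
    ((((hΘ β hβ).const_mul T).ofReal_comp).mul_const Complex.I).cexp
  set κ : ℂ := -Complex.I / T with hκ
  have hTC : (T : ℂ) ≠ 0 := by exact_mod_cast hT.ne'
  have hκT : Complex.I * T * κ = 1 := by
    rw [hκ]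
    field_simp
    simp
  have hκnorm : ‖κ‖ = 1 / T := by
    rw [hκ, norm_div, norm_neg, Complex.norm_I, Complex.norm_real, Real.norm_eq_abs,
      abs_of_pos hT]
  set W : ℝ → Qubits n := fun z => ofEnergy E (correctorAmp E z) with hW
  set V' : ℝ → Qubits n := fun z => ofEnergy E (groundAmpDeriv E z) with hV'
  set sp : ℝ → ℝ := fun β => c * secularGap E (Z β) ^ 2 with hsp
  -- The rescaled evolution.
  set φ : ℝ → Qubits n := fun β => ψ (T * β) with hφ
  have hφd : ∀ β ∈ Icc (0 : ℝ) 1,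
      HasDerivWithinAt φ (-(Complex.I * T) • hamiltonian E (Z β) (φ β)) (Icc 0 1) β := by
    intro β hβ
    have h2 : HasDerivWithinAt (fun β : ℝ => T * β) T (Icc 0 1) β := by
      simpa using ((hasDerivAt_id β).const_mul T).hasDerivWithinAt
    have h3 := hψ.schrodinger (T * β) ⟨by have := hβ.1; positivity,
      mul_le_of_le_one_right hT.le hβ.2⟩
    have hmaps : MapsTo (fun β : ℝ => T * β) (Icc 0 1) (Icc 0 T) := fun b hb =>
      ⟨by have := hb.1; positivity, mul_le_of_le_one_right hT.le hb.2⟩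
    have h4 := HasDerivWithinAt.scomp β h3 h2 hmaps
    rw [mul_div_cancel_left₀ _ hT.ne'] at h4
    refine h4.congr_deriv ?_
    rw [← Complex.coe_smul, smul_smul]
    congr 1
    ring
  have hcor : ∀ β ∈ Icc (0 : ℝ) 1, ‖κ • p β • (sp β : ℂ) • W (Z β)‖ ≤ c * m / T := by
    intro β hβ
    have hg := hgpos β hβ
    obtain ⟨h2, -⟩ := exists_corrector_bounds h0 h1 hm (hZ.mem β hβ).1
    rw [norm_smul, norm_smul, norm_smul, hκnorm, hpnorm, one_mul, Complex.norm_real,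
      Real.norm_eq_abs, hsp, abs_of_nonneg (by positivity)]
    calc 1 / T * (c * secularGap E (Z β) ^ 2 * ‖W (Z β)‖)
        ≤ 1 / T * (c * secularGap E (Z β) ^ 2 * (m / secularGap E (Z β) ^ 2)) := by gcongr
      _ = c * m / T := by field_simp
  set d : ℝ → Qubits n := fun β =>
    φ β - p β • groundVec E (Z β) + κ • p β • (sp β : ℂ) • W (Z β) with hd
  have hderiv : ∀ β ∈ Icc (0 : ℝ) 1, ∃ f : Qubits n,
      HasDerivWithinAt d (-(Complex.I * T) • hamiltonian E (Z β) (d β) + f) (Icc 0 1) β ∧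
      ‖f‖ ≤ 6 * m ^ 2 * c / T * (c * secularGap E (Z β)) := by
    intro β hβ
    have hz := (hZ.mem β hβ).1
    have hz' := mem_groundRange h0 hz
    have hg := hgpos β hβ
    obtain ⟨hWn, W', hWd, hWn'⟩ := exists_corrector_bounds h0 h1 hm hz
    obtain ⟨k', hk', hkd⟩ := hZ.exists_hasDerivAt_speed h0 h1 hm hβ
    have e1 : HasDerivAt (fun β => groundVec E (Z β)) (sp β • V' (Z β)) β :=
      (hasDerivAt_groundVec hz').scomp β (hZ.ode β hβ)
    have e2 : HasDerivAt (fun β => W (Z β)) (sp β • W') β := HasDerivAt.scomp β hWd (hZ.ode β hβ)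
    have e3 := ((hpd β hβ).fun_smul (hkd.ofReal_comp.fun_smul e2)).fun_const_smul κ
    have e4 := ((hφd β hβ).fun_sub ((hpd β hβ).fun_smul e1).hasDerivWithinAt).fun_add
      e3.hasDerivWithinAt
    refine ⟨κ • p β • ((k' : ℂ) • W (Z β) + ((sp β ^ 2 : ℝ) : ℂ) • W'), ?_, ?_⟩
    · refine e4.congr_deriv ?_
      have hHV := hamiltonian_groundVec hz'
      have hHW : hamiltonian E (Z β) (W (Z β)) =
          V' (Z β) - (groundDepth E (Z β) : ℂ) • W (Z β) := by
        rw [eq_sub_iff_add_eq, ← shiftedHamiltonian_apply]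
        exact shiftedHamiltonian_corrector hz'
      simp only [hd, map_add, map_sub, map_smul, hHV, hHW]
      simp only [← Complex.coe_smul (E := Qubits n), hsp]
      have hκV : (Complex.I * T * κ) • V' (Z β) = V' (Z β) := by rw [hκT, one_smul]
      push_cast
      linear_combination (norm := module) (p β * (c * (secularGap E (Z β) : ℂ) ^ 2)) • hκV
    · rw [norm_smul, norm_smul, hκnorm, hpnorm, one_mul]
      have h2 : ‖(k' : ℂ) • W (Z β) + ((sp β ^ 2 : ℝ) : ℂ) • W'‖ ≤
          2 * c ^ 2 * m * secularGap E (Z β) ^ 3 * (m / secularGap E (Z β) ^ 2) +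
            (c * secularGap E (Z β) ^ 2) ^ 2 * (4 * m ^ 2 / secularGap E (Z β) ^ 3) := by
        refine (norm_add_le _ _).trans ?_
        rw [norm_smul, norm_smul, Complex.norm_real, Complex.norm_real, Real.norm_eq_abs,
          Real.norm_eq_abs, abs_of_nonneg (sq_nonneg (sp β))]
        gcongr
      refine (mul_le_mul_of_nonneg_left h2 (by positivity)).trans_eq ?_
      field_simp
      ring
  choose! f hfd hfn using hderiv
  have hmain := norm_le_add_of_hasDerivWithinAt hfd
    (fun β _ => re_inner_smul_hamiltonian (Z β) T (d β))
    (fun β hβ => (hΛ β hβ).const_mul (6 * m ^ 2 * c / T)) hfn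
  rw [hΛ0, hΛ1] at hmain
  have hd0 : d 0 = κ • p 0 • (sp 0 : ℂ) • W (Z 0) := by
    simp only [hd, hφ, mul_zero, hψ.initial, hZ.initial, groundVec_zero, hp0, one_smul, sub_self,
      zero_add]
  have hd1 : ψ T - p 1 • groundVec E zf = d 1 - κ • p 1 • (sp 1 : ℂ) • W (Z 1) := by
    simp only [hd, hφ, mul_one, hZ.final, add_sub_cancel_right]
  refine ⟨p 1, hpnorm 1, ?_⟩
  rw [hd1]
  refine (norm_sub_le _ _).trans ?_
  have h2 := hcor 1 (right_mem_Icc.2 zero_le_one)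
  have h3 := hcor 0 (left_mem_Icc.2 zero_le_one)
  rw [← hd0] at h3
  calc ‖d 1‖ + ‖κ • p 1 • (sp 1 : ℂ) • W (Z 1)‖ ≤ _ := add_le_add (hmain.trans (add_le_add_left h3 _)) h2
    _ = _ := by
      ring

end adiabatic

/-! ### Polynomial bounds -/

/-- The bound on the cost, made explicit with the integrals of `g⁻²` and `g⁻¹` estimated for
`g ≥ √(N₀ / N) / (8 m)`. The inequality is strict because `π < 4`. -/
theorem cost_lt {E : (Fin n → Bool) → ℕ} (h0 : 0 < numSolutions E) (h1 : ∃ s, E s ≠ 0) {m q : ℕ}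
    (hm : ∀ s, E s ≤ m) {zf : ℝ} (hzf : 0 < zf) (hq : zf ≤ q) :
    2 * (∫ x in (0 : ℝ)..zf, 1 / secularGap E x ^ 2) * m +
      9 * m ^ 2 * (∫ x in (0 : ℝ)..zf, 1 / secularGap E x ^ 2) *
        (∫ x in (0 : ℝ)..zf, 1 / secularGap E x) <
    (128 * m ^ 2 + 2304 * m ^ 3 * (n + 16 * m * (q + 1))) *
      Real.sqrt (2 ^ n / numSolutions E) := by
  have hm1 : (1 : ℝ) ≤ m := by
    obtain ⟨s, hs⟩ := h1
    exact_mod_cast (Nat.one_le_iff_ne_zero.2 hs).trans (hm s)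
  have hp := solutionFraction_pos h0
  have hp1 := solutionFraction_le_one E
  have hN0 : (1 : ℝ) ≤ numSolutions E := by exact_mod_cast h0
  have hR : Real.sqrt (2 ^ n / numSolutions E) = (Real.sqrt (solutionFraction E))⁻¹ := by
    rw [solutionFraction_eq, ← Real.sqrt_inv, inv_div]
  have hr : 0 < Real.sqrt (solutionFraction E) := Real.sqrt_pos.2 hp
  set R := Real.sqrt (2 ^ n / numSolutions E) with hRdef
  have hR1 : 1 ≤ R := by
    rw [hR]
    exact (one_le_inv₀ hr).2 (Real.sqrt_le_one.2 hp1)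
  have hRn : R ≤ 2 ^ n := by
    have hN : (1 : ℝ) ≤ 2 ^ n := one_le_pow₀ (by norm_num)
    refine Real.sqrt_le_iff.2 ⟨by positivity, ?_⟩
    rw [div_le_iff₀ (by positivity)]
    nlinarith
  have ha : 0 < Real.sqrt (solutionFraction E) / (8 * m) := by positivity
  have hga : ∀ z, 0 ≤ z → Real.sqrt (solutionFraction E) / (8 * m) ≤ secularGap E z :=
    fun z hz => sqrt_le_secularGap h0 h1 hm hz
  have hc := integral_inv_secularGap_sq_le h0 h1 ha hzf.le hga
  have hL := integral_inv_secularGap_le h0 h1 ha hzf.le hq hga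
  have hLnn : 0 ≤ ∫ x in (0 : ℝ)..zf, 1 / secularGap E x :=
    intervalIntegral.integral_nonneg hzf.le fun x hx =>
      (one_div_pos.2 (secularGap_pos h0 h1 hx.1)).le
  set c := ∫ x in (0 : ℝ)..zf, 1 / secularGap E x ^ 2
  set L := ∫ x in (0 : ℝ)..zf, 1 / secularGap E x
  have hc' : c < 64 * m * R := by
    have h2 : 2 * Real.pi / (Real.sqrt (solutionFraction E) / (8 * m)) = Real.pi * (16 * m * R) := by
      rw [hR]
      field_simp
      ring
    rw [h2] at hc
    have : Real.pi * (16 * m * R) < 4 * (16 * m * R) := by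
      have := Real.pi_lt_four
      gcongr
    linarith
  have hL' : L ≤ 4 * (n + 16 * m * (q + 1)) := by
    have h2 : 2 * (((q : ℝ) + 1) / (Real.sqrt (solutionFraction E) / (8 * m))) =
        16 * m * (q + 1) * R := by
      rw [hR]
      field_simp
      ring
    rw [h2] at hL
    have h3 : Real.log (1 + 16 * m * (q + 1) * R) ≤ n + 16 * m * (q + 1) := by
      have h4 : 1 + 16 * m * (q + 1) * R ≤ R * (1 + 16 * m * (q + 1)) := by nlinarith
      have h5 : Real.log R ≤ n := by
        calc Real.log R ≤ Real.log (2 ^ n) := Real.log_le_log (by linarith) hRn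
          _ = n * Real.log 2 := by rw [Real.log_pow]
          _ ≤ n * 1 := by
            have := Real.log_two_lt_d9
            gcongr
            linarith
          _ = n := mul_one _
      have h6 : Real.log (1 + 16 * m * (q + 1)) ≤ 16 * m * (q + 1) := by
        have := Real.log_le_sub_one_of_pos (x := 1 + 16 * (m : ℝ) * (q + 1)) (by positivity)
        linarith
      calc Real.log (1 + 16 * m * (q + 1) * R) ≤ Real.log (R * (1 + 16 * m * (q + 1))) :=
            Real.log_le_log (by positivity) h4
        _ = Real.log R + Real.log (1 + 16 * m * (q + 1)) :=
            Real.log_mul (by positivity) (by positivity)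
        _ ≤ _ := by linarith
    linarith
  have hm0 : (0 : ℝ) < m := by linarith
  have h2 : 2 * c * m < 2 * (64 * m * R) * m := by gcongr
  have h3 : 9 * m ^ 2 * c * L ≤ 9 * m ^ 2 * (64 * m * R) * (4 * (n + 16 * m * (q + 1))) := by
    gcongr
  calc 2 * c * m + 9 * m ^ 2 * c * L
      < 2 * (64 * m * R) * m + 9 * m ^ 2 * (64 * m * R) * (4 * (n + 16 * m * (q + 1))) :=
        add_lt_add_of_lt_of_le h2 h3
    _ = _ := by ring

end Annealing

end

theorem lemma1 (M Q : Polynomial ℕ) :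
    ∃ P : Polynomial ℕ,
      ∀ (n : ℕ) (E : (Fin n → Bool) → ℕ),
        (∀ s, E s ≤ M.eval n) → 0 < Annealing.numSolutions E → (∃ s, E s ≠ 0) →
        ∀ zf : ℝ, 0 < zf → zf ≤ ((Q.eval n : ℕ) : ℝ) →
          (∀ z ∈ Set.Icc 0 zf, 0 < Annealing.gap E z) ∧
          ∃ (c : ℝ) (z : ℝ → ℝ),
            c = (∫ x in (0 : ℝ)..zf, 1 / Annealing.gap E x ^ 2) ∧
            Annealing.IsLocalSchedule E zf c z ∧
            Annealing.adiabaticCost E z ≤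
              ENNReal.ofReal (((P.eval n : ℕ) : ℝ) *
                Real.sqrt ((2 : ℝ) ^ n / (Annealing.numSolutions E : ℝ))) ∧
            ∀ ε : ℝ, 0 < ε → ∀ T : ℝ,
              ((P.eval n : ℕ) : ℝ) *
                Real.sqrt ((2 : ℝ) ^ n / (Annealing.numSolutions E : ℝ)) / ε ≤ T →
              ∀ ψ : ℝ → Annealing.Qubits n, Annealing.IsEvolution E z T ψ →
                ∃ v : Annealing.Qubits n,
                  Annealing.IsGroundState (Annealing.hamiltonian E zf) v ∧ ‖ψ T - v‖ < ε := by
  refine ⟨128 * M ^ 2 + 2304 * M ^ 3 * (Polynomial.X + 16 * M * (Q + 1)),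
    fun n E hm h0 h1 zf hzf hq => ?_⟩
  have hlt := Annealing.cost_lt h0 h1 hm hzf hq
  have hP : (((128 * M ^ 2 + 2304 * M ^ 3 * (Polynomial.X + 16 * M * (Q + 1))).eval n : ℕ) : ℝ) =
      128 * (M.eval n : ℕ) ^ 2 +
        2304 * (M.eval n : ℕ) ^ 3 * (n + 16 * (M.eval n : ℕ) * ((Q.eval n : ℕ) + 1)) := by
    simp
  rw [hP]
  refine ⟨fun z hz => ?_, ?_⟩
  · rw [Annealing.gap_eq_secularGap h0 h1 hz.1]
    exact Annealing.secularGap_pos h0 h1 hz.1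
  obtain ⟨Z, hZ⟩ := Annealing.exists_isSecularSchedule h0 h1 hzf
  have hcint : (∫ x in (0 : ℝ)..zf, 1 / Annealing.secularGap E x ^ 2) =
      ∫ x in (0 : ℝ)..zf, 1 / Annealing.gap E x ^ 2 := by
    refine intervalIntegral.integral_congr fun x hx => ?_
    rw [Set.uIcc_of_le hzf.le] at hx
    simp only [Annealing.gap_eq_secularGap h0 h1 hx.1]
  have hcnn : 0 ≤ ∫ x in (0 : ℝ)..zf, 1 / Annealing.secularGap E x ^ 2 :=
    intervalIntegral.integral_nonneg hzf.le fun x hx => by positivity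
  have hLnn : 0 ≤ ∫ x in (0 : ℝ)..zf, 1 / Annealing.secularGap E x :=
    intervalIntegral.integral_nonneg hzf.le fun x hx =>
      (one_div_pos.2 (Annealing.secularGap_pos h0 h1 hx.1)).le
  have hcost := hZ.adiabaticCost_le h0 h1 hm hzf hcnn
  refine ⟨_, Z, hcint, hZ.isLocalSchedule h0 h1,
    hcost.trans (ENNReal.ofReal_le_ofReal hlt.le), fun ε hε T hT ψ hψ => ?_⟩
  rw [div_le_iff₀ hε] at hT
  have hTpos : 0 < T := by
    have h2 : 0 < T * ε := lt_of_le_of_lt (by positivity) (hlt.trans_le hT)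
    exact (pos_iff_pos_of_mul_pos h2).2 hε
  obtain ⟨k, hk, hψk⟩ := hZ.exists_norm_sub_le h0 h1 hm hzf hcnn hTpos hψ
  refine ⟨_, Annealing.isGroundState_groundVec h0 hzf.le hk, hψk.trans_lt ?_⟩
  rw [div_lt_iff₀ hTpos, mul_comm ε]
  refine lt_of_le_of_lt ?_ (hlt.trans_le hT)
  gcongr
  norm_num
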